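/- **Notation.** Let $n\ge 2$. A pair $(p,q)$ is *admissible* if $p,q\in[2,\infty]$, $\frac1p+\frac n{2q}=\frac n4$ and $(n,p,q)\ne(2,2,\infty)$. For an interval $I\subseteq[0,\infty)$ let $\|f\|_{L^p(I;L^q)}=\big\|\,\|f(t,\cdot)\|_{L^q(\mathbb R^n)}\big\|_{L^p(I)}\in[0,\infty]$. For a real valued potential $V(t,x)$ consider $$ i\partial_t u-\Delta u+V(t,x)u=0 \qquad (\ast) $$ on $I=[0,\infty)$ or $I=[0,T]$. A solution of $(\ast)$ on $I$ is a function $u\in C(I;L^2(\mathbb R^n))$ that satisfies the equation in integral form, $u(t)=e^{-it\Delta}u(0)+i\int_0^t e^{-i(t-\tau)\Delta}V(\tau)u(\tau)\,d\tau$ for all $t\in I$, where the integral converges absolutely in $L^2$. **Theorem.** Let $n\ge2$. (i) There are a real valued potential $W\in C_0^\infty(\mathbb R^n)$ and a (smooth) function $u_0$ with $u_0\in H^\sigma(\mathbb R^n)$ for all $\sigma>0$ such that $$-\Delta u_0+W u_0+u_0=0 .$$ The potential $V(t,x)\equiv W(x)$ belongs to $L^\infty([0,\infty);L^s)$ for every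 $s\in[1,\infty]$ (in particular for $s=n/2$), and the function $u(t,x)=e^{-it}u_0(x)\in C([0,\infty);L^2)$ is a solution of $(\ast)$ on $[0,\infty)$ with this $V$ and $\|u\|_{L^p([0,\infty);L^q)}=\infty$ for every admissible pair $(p,q)\neq(\infty,2)$. Consequently, for every such pair, there is no constant $C$ with $\|v\|_{L^p([0,\infty);L^q)}\le C\|v(0)\|_{L^2}$ for all solutions $v$ of $(\ast)$ on $[0,\infty)$. (ii) For every pair $(r,s)$ with $r\in[1,\infty)$, $s\in(n/2,\infty]$ and $\frac1r+\frac n{2s}\ne1$ there are a real valued potential $V\in L^r([0,\infty);L^s)$ and a sequence of solutions $u_k\in C([0,\infty);L^2)$ of $(\ast)$ on $[0,\infty)$ with $u_k(0)\ne0$ such that $$\lim_{k\to\infty}\frac{\|u_k\|_{L^p([0,\infty);L^q)}}{\|u_k(0)\|_{L^2}}=\infty\qquad\text{for every admissible pair }(p,q)\ne(\infty,2).$$ (iii) For every pair $(r,s)$ with $r\in[1,\infty)$, $s\in(n/2,\infty]$ and $\frac1r+\frac n{2s}>1$ and every $T>0$ there are a real valued potential $V\in L^r([0,T];L^s)$ and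 a sequence of solutions $u_k\in C([0,T];L^2)$ of $(\ast)$ on $[0,T]$ with $u_k(0)\ne0$ such that $$\lim_{k\to\infty}\frac{\|u_k\|_{L^p([0,T];L^q)}}{\|u_k(0)\|_{L^2}}=\infty\qquad\text{for every admissible pair }(p,q)\ne(\infty,2).$$ -/

import Mathlib

open MeasureTheory Filter Topology
open scoped ENNReal NNReal ContDiff FourierTransform SchwartzMap Laplacian

noncomputable section

namespace Schrodinger

/-- Euclidean space `ℝⁿ`. -/
abbrev Space (n : ℕ) : Type := EuclideanSpace ℝ (Fin n)

/-- The Hilbert space `L²(ℝⁿ; ℂ)`. -/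
abbrev L2 (n : ℕ) : Type := Lp ℂ 2 (volume : Measure (Space n))

/-- `(p, q)` is Schrödinger admissible in dimension `n`:
`1/p + n/(2q) = n/4`, `p, q ∈ [2, ∞]`, `(n, p, q) ≠ (2, 2, ∞)`. -/
def Admissible (n : ℕ) (p q : ℝ≥0∞) : Prop :=
  1 / p + (n : ℝ≥0∞) / (2 * q) = (n : ℝ≥0∞) / 4 ∧ 2 ≤ p ∧ 2 ≤ q ∧
    ¬ (n = 2 ∧ p = 2 ∧ q = ⊤)

/-- The mixed norm `‖f‖_{L^p(I; L^q(ℝⁿ))}`, with values in `[0, ∞]`. -/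
def mixedNorm {n : ℕ} {F : Type*} [NormedAddCommGroup F] (I : Set ℝ) (p q : ℝ≥0∞)
    (f : ℝ → Space n → F) : ℝ≥0∞ :=
  eLpNorm (fun t => eLpNorm (f t) q volume) p (volume.restrict I)

/-- `V ∈ L^r(I; L^s(ℝⁿ))` for a real valued function `V(t, x)`. -/
def MemMixed {n : ℕ} (I : Set ℝ) (r s : ℝ≥0∞) (V : ℝ → Space n → ℝ) : Prop :=
  AEStronglyMeasurable (Function.uncurry V)
    ((volume.restrict I).prod (volume : Measure (Space n))) ∧
  mixedNorm I r s V < ⊤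

/-- The symbol `exp(i t |2πξ|²)` of `e^{-itΔ}`; Mathlib's Fourier transform has the kernel
`exp(-2πi x·ξ)`, so `Δ` has the symbol `-|2πξ|²`. -/
def freeSymbol (n : ℕ) (t : ℝ) (ξ : Space n) : ℂ :=
  Complex.exp (((t * (2 * Real.pi * ‖ξ‖) ^ 2 : ℝ) : ℂ) * Complex.I)

theorem memLp_freeSymbol_mul {n : ℕ} (t : ℝ) (g : L2 n) :
    MemLp (fun ξ => freeSymbol n t ξ * g ξ) 2 (volume : Measure (Space n)) := by
  have hc : Continuous (freeSymbol n t) := by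
    unfold freeSymbol
    fun_prop
  refine (Lp.memLp g).of_le (hc.aestronglyMeasurable.mul (Lp.aestronglyMeasurable g)) ?_
  refine Eventually.of_forall fun ξ => ?_
  rw [norm_mul, freeSymbol, Complex.norm_exp_ofReal_mul_I, one_mul]

/-- The free propagator `e^{-itΔ}` on `L²(ℝⁿ)`, i.e. the solution operator of
`i ∂ₜ u - Δ u = 0`, as a Fourier multiplier. -/
def freePropagator {n : ℕ} (t : ℝ) (f : L2 n) : L2 n :=
  𝓕⁻ ((memLp_freeSymbol_mul t (𝓕 f : L2 n)).toLp _ : L2 n)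

/-- `u ∈ C(I; L²)` solves `i ∂ₜ u - Δ u + V(t, x) u = 0` on the time interval `I ∋ 0`, in the
integral form `u(t) = e^{-itΔ} u(0) + i ∫₀ᵗ e^{-i(t-τ)Δ} [V(τ) u(τ)] dτ` for all `t ∈ I`.
Here `G τ` is the element of `L²` represented by `V(τ) u(τ)`, and the integral is an absolutely
convergent (Bochner) integral in `L²`. -/
structure IsSolution {n : ℕ} (I : Set ℝ) (V : ℝ → Space n → ℝ) (u : ℝ → L2 n) : Prop where
  continuousOn : ContinuousOn u I
  duhamel : ∃ G : ℝ → L2 n,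
    (∀ᵐ τ ∂(volume.restrict I),
      (G τ : Space n → ℂ) =ᵐ[volume] fun x => (V τ x : ℂ) * u τ x) ∧
    ∀ t ∈ I,
      IntervalIntegrable (fun τ => freePropagator (t - τ) (G τ)) volume 0 t ∧
      u t = freePropagator t (u 0) +
        Complex.I • ∫ τ in (0 : ℝ)..t, freePropagator (t - τ) (G τ)

/-- The norm `‖u‖_{L^p(I; L^q)}` of an `L²` valued function. -/
def strichartzNorm {n : ℕ} (I : Set ℝ) (p q : ℝ≥0∞) (u : ℝ → L2 n) : ℝ≥0∞ :=
  mixedNorm I p q (fun t => (u t : Space n → ℂ))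

/-- The standing wave `t ↦ e^{-it} f`. -/
def standingWave {n : ℕ} (f : L2 n) (t : ℝ) : L2 n :=
  Complex.exp (-(Complex.I * t)) • f

end Schrodinger

end

noncomputable section

namespace Schrodinger

open scoped BoundedContinuousFunction ComplexInnerProductSpace

/-- The Laplacian is the sum of the second derivatives along coordinate lines. -/
theorem laplacian_eq_sum_deriv {n : ℕ} {F : Type*} [NormedAddCommGroup F] [NormedSpace ℝ F]
    {f : Space n → F} (hf : ContDiff ℝ 2 f) (x : Space n) :
    Δ f x = ∑ i, deriv (deriv fun t : ℝ => f (x + t • EuclideanSpace.basisFun (Fin n) ℝ i)) 0 := by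
  rw [InnerProductSpace.laplacian_eq_iteratedFDeriv_orthonormalBasis f
    (EuclideanSpace.basisFun (Fin n) ℝ)]
  refine Finset.sum_congr rfl fun i _ => ?_
  set v := EuclideanSpace.basisFun (Fin n) ℝ i
  have h1 : (fun t : ℝ => f (x + t • v))
      = (fun y => f (x + y)) ∘ (ContinuousLinearMap.toSpanSingleton ℝ v) := by
    ext t; simp [ContinuousLinearMap.toSpanSingleton_apply]
  have hf' : ContDiff ℝ 2 (fun y => f (x + y)) := hf.comp (contDiff_const.add contDiff_id)
  have h2 : deriv (deriv fun t : ℝ => f (x + t • v)) 0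
      = iteratedDeriv 2 (fun t : ℝ => f (x + t • v)) 0 := by
    rw [iteratedDeriv_succ, iteratedDeriv_one]
  rw [h2, h1, iteratedDeriv_eq_iteratedFDeriv,
    ContinuousLinearMap.iteratedFDeriv_comp_right _ hf' _ le_rfl,
    iteratedFDeriv_comp_add_left]
  simp only [ContinuousMultilinearMap.compContinuousLinearMap_apply, map_zero, add_zero]
  congr 1
  ext j
  fin_cases j <;> simp [ContinuousLinearMap.toSpanSingleton_apply]

theorem deriv_deriv_nonneg_of_isLocalMin {g : ℝ → ℝ} {x : ℝ} (h : IsLocalMin g x)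
    (hc : ContinuousAt g x) : 0 ≤ deriv (deriv g) x := by
  by_contra! hneg
  have hmax := isLocalMax_of_deriv_deriv_neg hneg h.deriv_eq_zero hc
  have heq : g =ᶠ[𝓝 x] fun _ => g x := by
    filter_upwards [h, hmax] with y h1 h2 using le_antisymm h2 h1
  have : deriv (deriv g) x = 0 := by
    rw [heq.deriv.deriv_eq]; simp
  linarith

theorem laplacian_nonneg_of_isMin {n : ℕ} {f : Space n → ℝ} (hf : ContDiff ℝ 2 f) {x : Space n}
    (h : ∀ y, f x ≤ f y) : 0 ≤ Δ f x := by
  rw [laplacian_eq_sum_deriv hf]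
  refine Finset.sum_nonneg fun i _ => deriv_deriv_nonneg_of_isLocalMin ?_ ?_
  · exact Eventually.of_forall fun t => by simpa using h _
  · exact (hf.continuous.comp (by fun_prop)).continuousAt

/-- The maximum principle for `1 - Δ` on the whole space. -/
theorem nonneg_of_sub_laplacian_nonneg {n : ℕ} {f : Space n → ℝ} (hf : ContDiff ℝ 2 f)
    (h0 : Tendsto f (cocompact _) (𝓝 0)) (h : ∀ x, 0 ≤ -(Δ f x) + f x) (x : Space n) :
    0 ≤ f x := by
  by_contra! hx
  obtain ⟨y, hy⟩ := hf.continuous.exists_forall_le' x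
    ((h0.eventually (lt_mem_nhds hx)).mono fun _ h => h.le)
  have := laplacian_nonneg_of_isMin hf hy
  linarith [h y, hy x]

theorem contDiff_exp_neg_norm_sq {n : ℕ} {k : WithTop ℕ∞} :
    ContDiff ℝ k (fun x : Space n => Real.exp (-‖x‖ ^ 2)) :=
  (contDiff_norm_sq ℝ).neg.exp

theorem laplacian_exp_neg_norm_sq {n : ℕ} (x : Space n) :
    Δ (fun x : Space n => Real.exp (-‖x‖ ^ 2)) x
      = (4 * ‖x‖ ^ 2 - 2 * n) * Real.exp (-‖x‖ ^ 2) := by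
  rw [laplacian_eq_sum_deriv contDiff_exp_neg_norm_sq]
  have h : ∀ i : Fin n, deriv (deriv fun t : ℝ =>
      Real.exp (-‖x + t • EuclideanSpace.basisFun (Fin n) ℝ i‖ ^ 2)) 0
      = (4 * x i ^ 2 - 2) * Real.exp (-‖x‖ ^ 2) := by
    intro i
    have hq : ∀ t : ℝ, ‖x + t • EuclideanSpace.basisFun (Fin n) ℝ i‖ ^ 2
        = ‖x‖ ^ 2 + 2 * t * x i + t ^ 2 := by
      intro t
      rw [norm_add_sq_real, inner_smul_right, norm_smul, mul_pow]
      simp [EuclideanSpace.inner_single_right]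
      ring
    have hd : ∀ t : ℝ, HasDerivAt (fun t : ℝ => Real.exp (-(‖x‖ ^ 2 + 2 * t * x i + t ^ 2)))
        (Real.exp (-(‖x‖ ^ 2 + 2 * t * x i + t ^ 2)) * (-(2 * x i + 2 * t))) t := by
      intro t
      have : HasDerivAt (fun t : ℝ => -(‖x‖ ^ 2 + 2 * t * x i + t ^ 2)) (-(2 * x i + 2 * t)) t := by
        have h1 := (((hasDerivAt_id t).const_mul 2).mul_const (x i)).const_add (‖x‖ ^ 2)
        convert! (h1.add ((hasDerivAt_id t).pow 2)).neg using 1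
        simp
      exact this.exp
    simp_rw [hq]
    rw [show (deriv fun t : ℝ => Real.exp (-(‖x‖ ^ 2 + 2 * t * x i + t ^ 2))) = fun t =>
      Real.exp (-(‖x‖ ^ 2 + 2 * t * x i + t ^ 2)) * (-(2 * x i + 2 * t)) from
      funext fun t => (hd t).deriv]
    have h2 : HasDerivAt (fun t : ℝ => -(2 * x i + 2 * t)) (-2) 0 := by
      convert! (((hasDerivAt_id (0 : ℝ)).const_mul 2).const_add (2 * x i)).neg using 1
      simp
    refine ((hd 0).mul h2).deriv.trans ?_
    simp
    ring
  simp_rw [h]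
  rw [← Finset.sum_mul, Finset.sum_sub_distrib, ← Finset.mul_sum, EuclideanSpace.real_norm_sq_eq]
  simp [mul_comm]

theorem laplacian_comp_affine {n : ℕ} {F : Type*} [NormedAddCommGroup F] [NormedSpace ℝ F]
    {f : Space n → F} (hf : ContDiff ℝ 2 f) (a : ℝ) (c x : Space n) :
    Δ (fun x => f (a • (x - c))) x = a ^ 2 • Δ f (a • (x - c)) := by
  have h1 : (fun x => f (a • (x - c))) = fun x =>
      (f ∘ (a • ContinuousLinearMap.id ℝ (Space n))) (x - c) := by
    ext; simp
  simp only [InnerProductSpace.laplacian_eq_iteratedFDeriv_stdOrthonormalBasis]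
  rw [h1, iteratedFDeriv_comp_sub, ContinuousLinearMap.iteratedFDeriv_comp_right _ hf _ le_rfl,
    Finset.smul_sum]
  refine Finset.sum_congr rfl fun i _ => ?_
  simp only [ContinuousMultilinearMap.compContinuousLinearMap_apply]
  have := (iteratedFDeriv ℝ 2 f (a • (x - c))).map_smul_univ (fun _ => a)
    ![(stdOrthonormalBasis ℝ (Space n)) i, (stdOrthonormalBasis ℝ (Space n)) i]
  simpa using this

/-- The symbol of `(1 - Δ)⁻¹`. -/
def resolventSymbol (n : ℕ) (ξ : Space n) : ℝ := (1 + ‖(2 * Real.pi) • ξ‖ ^ 2) ^ (-1 : ℝ)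

theorem hasTemperateGrowth_resolventSymbol (n : ℕ) :
    (resolventSymbol n).HasTemperateGrowth :=
  (Function.hasTemperateGrowth_one_add_norm_sq_rpow (Space n) (-1)).comp
    ((2 * Real.pi) • ContinuousLinearMap.id ℝ (Space n)).hasTemperateGrowth

/-- The resolvent `(1 - Δ)⁻¹` on Schwartz functions. -/
theorem exists_sub_laplacian_eq {n : ℕ} (φ : 𝓢(Space n, ℂ)) :
    ∃ u : 𝓢(Space n, ℂ), -Δ u + u = φ := by
  have hσ := hasTemperateGrowth_resolventSymbol n
  have hN : Function.HasTemperateGrowth (fun ξ : Space n => ‖ξ‖ ^ 2) := by fun_prop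
  refine ⟨SchwartzMap.fourierMultiplierCLM ℂ (resolventSymbol n) φ, ?_⟩
  rw [SchwartzMap.laplacian_eq_fourierMultiplierCLM,
    SchwartzMap.fourierMultiplierCLM_fourierMultiplierCLM_apply (by fun_prop) hσ]
  have hφ : φ = 𝓕⁻ (𝓕 φ) := (FourierTransform.fourierInv_fourier_eq φ).symm
  conv_rhs => rw [hφ]
  simp only [SchwartzMap.fourierMultiplierCLM_apply]
  rw [neg_smul, neg_neg, ← FourierTransform.fourierInv_smul, ← FourierTransform.fourierInv_add]
  congr 1
  ext ξ
  have h1 : SchwartzMap.smulLeftCLM ℂ ((fun ξ => ‖ξ‖ ^ 2) * resolventSymbol n) (𝓕 φ) ξ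
      = (‖ξ‖ ^ 2 * resolventSymbol n ξ) • 𝓕 φ ξ :=
    SchwartzMap.smulLeftCLM_apply_apply (hN.mul hσ) _ _
  have h2 : SchwartzMap.smulLeftCLM ℂ (resolventSymbol n) (𝓕 φ) ξ
      = resolventSymbol n ξ • 𝓕 φ ξ := SchwartzMap.smulLeftCLM_apply_apply hσ _ _
  rw [_root_.add_apply, _root_.smul_apply, h2]
  erw [h1]
  rw [smul_smul, ← add_smul]
  have : (2 * Real.pi) ^ 2 * (‖ξ‖ ^ 2 * resolventSymbol n ξ) + resolventSymbol n ξ = 1 := by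
    have hp : (1 + ‖(2 * Real.pi) • ξ‖ ^ 2) ≠ 0 := by positivity
    rw [resolventSymbol, Real.rpow_neg_one]
    field_simp
    rw [norm_smul, Real.norm_eq_abs, abs_of_pos (by positivity)]
    ring
  rw [this, one_smul]

/-- A compactly supported smooth potential with a bound state of energy `-1`. -/
theorem exists_boundState (n : ℕ) :
    ∃ (W : Space n → ℝ) (u : 𝓢(Space n, ℂ)), ContDiff ℝ ∞ W ∧ HasCompactSupport W ∧
      (∀ x, u x ≠ 0) ∧ ∀ x, -(Δ (u : Space n → ℂ)) x + (W x : ℂ) * u x + u x = 0 := by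
  let b : ContDiffBump (0 : Space n) := ⟨n + 1, n + 2, by positivity, by linarith⟩
  let φ₀ : Space n → ℝ := fun x => (1 + 2 * n) * b x
  have hφ₀ : ContDiff ℝ ∞ φ₀ := contDiff_const.mul b.contDiff
  have hφ₀s : HasCompactSupport φ₀ := b.hasCompactSupport.mul_left
  have hφc : HasCompactSupport (fun x => (φ₀ x : ℂ)) := hφ₀s.comp_left (g := Complex.ofReal) rfl
  obtain ⟨u, hu⟩ := exists_sub_laplacian_eq
    (hφc.toSchwartzMap (Complex.ofRealCLM.contDiff.comp hφ₀))
  have hu' : ∀ x, -(Δ (u : Space n → ℂ)) x + u x = φ₀ x := by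
    intro x
    have := congrArg (fun f : 𝓢(Space n, ℂ) => f x) hu
    simp only [_root_.add_apply, _root_.neg_apply, SchwartzMap.laplacian_apply] at this
    exact this
  have hsm : ContDiff ℝ 2 (u : Space n → ℂ) := u.smooth 2
  have hlim : Tendsto (u : Space n → ℂ) (cocompact _) (𝓝 0) := u.toZeroAtInfty.zero_at_infty'
  have hre : ∀ x, Δ (fun x => (u x).re) x = ((Δ (u : Space n → ℂ)) x).re := fun x =>
    hsm.contDiffAt.laplacian_CLM_comp_left (l := Complex.reCLM)
  have him : ∀ x, Δ (fun x => (u x).im) x = ((Δ (u : Space n → ℂ)) x).im := fun x =>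
    hsm.contDiffAt.laplacian_CLM_comp_left (l := Complex.imCLM)
  have hsre : ContDiff ℝ 2 (fun x => (u x).re) := Complex.reCLM.contDiff.comp hsm
  have hsim : ContDiff ℝ 2 (fun x => (u x).im) := Complex.imCLM.contDiff.comp hsm
  have hlre : Tendsto (fun x => (u x).re) (cocompact _) (𝓝 0) := by
    simpa [Function.comp_def] using (Complex.continuous_re.tendsto 0).comp hlim
  have hlim' : Tendsto (fun x => (u x).im) (cocompact _) (𝓝 0) := by
    simpa [Function.comp_def] using (Complex.continuous_im.tendsto 0).comp hlim
  have hpos : ∀ x, Real.exp (-‖x‖ ^ 2) ≤ (u x).re := by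
    intro x
    have hgauss : Tendsto (fun x : Space n => Real.exp (-‖x‖ ^ 2)) (cocompact _) (𝓝 0) :=
      Real.tendsto_exp_neg_atTop_nhds_zero.comp
        ((tendsto_pow_atTop two_ne_zero).comp tendsto_norm_cocompact_atTop)
    have key := nonneg_of_sub_laplacian_nonneg
      (f := (fun x => (u x).re) - fun x : Space n => Real.exp (-‖x‖ ^ 2))
      (hsre.sub contDiff_exp_neg_norm_sq) (by simpa [Pi.sub_def] using hlre.sub hgauss) ?_ x
    · simpa using key
    intro y
    rw [hsre.contDiffAt.laplacian_sub contDiff_exp_neg_norm_sq.contDiffAt, hre,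
      laplacian_exp_neg_norm_sq]
    have h1 := congrArg Complex.re (hu' y)
    simp only [Complex.add_re, Complex.neg_re, Complex.ofReal_re] at h1
    have h2 : (1 + 2 * n - 4 * ‖y‖ ^ 2) * Real.exp (-‖y‖ ^ 2) ≤ φ₀ y := by
      have he : Real.exp (-‖y‖ ^ 2) ≤ 1 := Real.exp_le_one_iff.2 (by nlinarith [sq_nonneg ‖y‖])
      have hep := Real.exp_pos (-‖y‖ ^ 2)
      have hn0 : (0 : ℝ) ≤ n := n.cast_nonneg
      rcases le_total ‖y‖ (n + 1) with hy | hy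
      · have : b y = 1 := b.one_of_mem_closedBall (by simpa [b] using hy)
        simp only [φ₀, this]
        nlinarith [mul_nonneg (sq_nonneg ‖y‖) hep.le]
      · have h3 : 0 ≤ φ₀ y := mul_nonneg (by positivity) b.nonneg
        have h4 : 1 + 2 * (n : ℝ) - 4 * ‖y‖ ^ 2 ≤ 0 := by nlinarith
        exact (mul_nonpos_of_nonpos_of_nonneg h4 hep.le).trans h3
    simp only [Pi.sub_apply]
    nlinarith
  have him0 : ∀ x, (u x).im = 0 := by
    have h1 : ∀ x, -((Δ (u : Space n → ℂ)) x).im + (u x).im = 0 := fun x => by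
      simpa using congrArg Complex.im (hu' x)
    intro x
    refine le_antisymm ?_ ?_
    · have key := nonneg_of_sub_laplacian_nonneg (f := -(fun x => (u x).im)) hsim.neg
        (by simpa [Pi.neg_def] using hlim'.neg) (fun y => ?_) x
      · simpa using key
      rw [InnerProductSpace.laplacian_neg, Pi.neg_apply, Pi.neg_apply, him]
      linarith [h1 y]
    · refine nonneg_of_sub_laplacian_nonneg (f := fun x => (u x).im) hsim hlim' (fun y => ?_) x
      rw [him]
      exact (h1 y).ge
  have hpos' : ∀ x, 0 < (u x).re := fun x => (Real.exp_pos _).trans_le (hpos x)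
  have hu_re : ∀ x, u x = ((u x).re : ℂ) := fun x => Complex.ext rfl (by simp [him0 x])
  refine ⟨fun x => -φ₀ x / (u x).re, u, ?_, ?_, fun x h => ?_, fun x => ?_⟩
  · exact hφ₀.neg.div (Complex.reCLM.contDiff.comp (u.smooth ⊤)) fun x => (hpos' x).ne'
  · simp_rw [div_eq_mul_inv]
    exact hφ₀s.neg.mul_right
  · have := hpos' x
    simp [h] at this
  · have h1 := hu' x
    rw [hu_re x] at h1 ⊢
    have h2 : ((u x).re : ℂ) ≠ 0 := by exact_mod_cast (hpos' x).ne'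
    push_cast
    field_simp
    linear_combination h1

theorem memLp_boundedContinuous_mul {n : ℕ} (w : Space n →ᵇ ℂ) (g : L2 n) :
    MemLp (fun x => w x * g x) 2 (volume : Measure (Space n)) :=
  (Lp.memLp g).of_le_mul (w.continuous.aestronglyMeasurable.mul (Lp.aestronglyMeasurable g))
    (Eventually.of_forall fun x => by
      rw [norm_mul]
      exact mul_le_mul_of_nonneg_right (w.norm_coe_le_norm x) (norm_nonneg _))

/-- Multiplication by a bounded continuous function on `L²`. -/
def mulL2 {n : ℕ} (w : Space n →ᵇ ℂ) : L2 n →L[ℂ] L2 n :=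
  LinearMap.mkContinuous
    { toFun := fun g => (memLp_boundedContinuous_mul w g).toLp _
      map_add' := fun f g => by
        rw [← MemLp.toLp_add]
        refine MemLp.toLp_congr _ _ ?_
        filter_upwards [Lp.coeFn_add f g] with x hx
        rw [hx, Pi.add_apply, Pi.add_apply, mul_add]
      map_smul' := fun c f => by
        rw [RingHom.id_apply, ← MemLp.toLp_const_smul]
        refine MemLp.toLp_congr _ _ ?_
        filter_upwards [Lp.coeFn_smul c f] with x hx
        simp [hx, mul_left_comm] } ‖w‖
    fun g => by
      refine Lp.norm_le_mul_norm_of_ae_le_mul ?_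
      filter_upwards [(memLp_boundedContinuous_mul w g).coeFn_toLp] with x hx
      simp only [LinearMap.coe_mk, AddHom.coe_mk, hx, norm_mul]
      exact mul_le_mul_of_nonneg_right (w.norm_coe_le_norm x) (norm_nonneg _)

theorem coeFn_mulL2 {n : ℕ} (w : Space n →ᵇ ℂ) (g : L2 n) :
    mulL2 w g =ᵐ[volume] fun x => w x * g x :=
  (memLp_boundedContinuous_mul w g).coeFn_toLp

theorem norm_mulL2_le {n : ℕ} (w : Space n →ᵇ ℂ) : ‖mulL2 w‖ ≤ ‖w‖ :=
  LinearMap.mkContinuous_norm_le _ (norm_nonneg _) _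

theorem mulL2_mul {n : ℕ} (v w : Space n →ᵇ ℂ) (g : L2 n) :
    mulL2 (v * w) g = mulL2 v (mulL2 w g) := by
  refine Lp.ext ?_
  filter_upwards [coeFn_mulL2 (v * w) g, coeFn_mulL2 v (mulL2 w g), coeFn_mulL2 w g]
    with x h1 h2 h3
  rw [h1, h2, h3, BoundedContinuousFunction.mul_apply, mul_assoc]

theorem norm_mulL2_apply_of_norm_eq_one {n : ℕ} {w : Space n →ᵇ ℂ} (hw : ∀ x, ‖w x‖ = 1)
    (g : L2 n) : ‖mulL2 w g‖ = ‖g‖ := by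
  rw [Lp.norm_def, Lp.norm_def]
  congr 1
  refine eLpNorm_congr_norm_ae ?_
  filter_upwards [coeFn_mulL2 w g] with x hx
  rw [hx, norm_mul, hw, one_mul]

/-- Uniformly bounded multipliers that tend to zero pointwise tend to zero strongly on `L²`. -/
theorem tendsto_mulL2_zero {n : ℕ} {ι : Type*} {l : Filter ι} [l.IsCountablyGenerated]
    {w : ι → Space n →ᵇ ℂ} {C : ℝ≥0} (hC : ∀ i x, ‖w i x‖ ≤ C)
    (h : ∀ x, Tendsto (fun i => w i x) l (𝓝 0)) (g : L2 n) :
    Tendsto (fun i => mulL2 (w i) g) l (𝓝 0) := by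
  rw [tendsto_zero_iff_norm_tendsto_zero]
  simp_rw [Lp.norm_def]
  rw [← ENNReal.toReal_zero]
  refine (ENNReal.tendsto_toReal ENNReal.zero_ne_top).comp ?_
  have h1 : ∀ i, eLpNorm (mulL2 (w i) g) 2 volume
      = (∫⁻ x, ‖w i x * g x‖ₑ ^ (2 : ℝ)) ^ (1 / (2 : ℝ)) := by
    intro i
    rw [eLpNorm_congr_ae (coeFn_mulL2 (w i) g),
      eLpNorm_eq_lintegral_rpow_enorm_toReal two_ne_zero ENNReal.ofNat_ne_top]
    simp
  simp_rw [h1]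
  have h2 : Tendsto (fun i => ∫⁻ x, ‖w i x * g x‖ₑ ^ (2 : ℝ)) l (𝓝 (∫⁻ _ : Space n, 0)) := by
    refine tendsto_lintegral_filter_of_dominated_convergence
      (fun x => ((C : ℝ≥0∞) * ‖g x‖ₑ) ^ (2 : ℝ)) ?_ ?_ ?_ ?_
    · refine Eventually.of_forall fun i => ?_
      have := (w i).continuous.measurable
      have := (Lp.stronglyMeasurable g).measurable
      fun_prop
    · refine Eventually.of_forall fun i => Eventually.of_forall fun x => ?_
      rw [enorm_mul]
      gcongr
      exact_mod_cast hC i x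
    · have hg := (Lp.memLp g).2
      rw [eLpNorm_lt_top_iff_lintegral_rpow_enorm_lt_top two_ne_zero ENNReal.ofNat_ne_top] at hg
      simp_rw [ENNReal.mul_rpow_of_nonneg _ _ (zero_le_two (α := ℝ))]
      rw [lintegral_const_mul' _ _ (by simp)]
      exact ENNReal.mul_ne_top (by simp) (by simpa using hg.ne)
    · refine Eventually.of_forall fun x => ?_
      have h3 : Tendsto (fun i => ‖w i x * g x‖ₑ) l (𝓝 0) := by
        simpa using ((h x).mul_const (g x)).enorm
      simpa using h3.ennrpow_const 2
  simpa using h2.ennrpow_const (1 / 2 : ℝ)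

/-- The symbol of the free propagator as a bounded continuous function. -/
def freeSymbolB (n : ℕ) (t : ℝ) : Space n →ᵇ ℂ :=
  BoundedContinuousFunction.ofNormedAddCommGroup (freeSymbol n t)
    (by unfold freeSymbol; fun_prop) 1
    fun ξ => by rw [freeSymbol, Complex.norm_exp_ofReal_mul_I]

theorem freeSymbolB_apply (n : ℕ) (t : ℝ) (ξ : Space n) : freeSymbolB n t ξ = freeSymbol n t ξ :=
  rfl

theorem norm_freeSymbol (n : ℕ) (t : ℝ) (ξ : Space n) : ‖freeSymbol n t ξ‖ = 1 := by
  rw [freeSymbol, Complex.norm_exp_ofReal_mul_I]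

theorem freeSymbolB_add (n : ℕ) (s t : ℝ) :
    freeSymbolB n (s + t) = freeSymbolB n s * freeSymbolB n t := by
  ext ξ
  simp only [BoundedContinuousFunction.mul_apply, freeSymbolB_apply, freeSymbol]
  rw [← Complex.exp_add]
  push_cast
  ring_nf

/-- The free propagator as a linear isometry. -/
def free {n : ℕ} (t : ℝ) : L2 n →ₗᵢ[ℂ] L2 n where
  toLinearMap := (Lp.fourierTransformₗᵢ (Space n) ℂ).symm.toLinearEquiv.toLinearMap ∘ₗ
    (mulL2 (freeSymbolB n t)).toLinearMap ∘ₗ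
      (Lp.fourierTransformₗᵢ (Space n) ℂ).toLinearEquiv.toLinearMap
  norm_map' f := by
    simp only [LinearMap.comp_apply]
    refine ((Lp.fourierTransformₗᵢ (Space n) ℂ).symm.norm_map _).trans ?_
    exact (norm_mulL2_apply_of_norm_eq_one (norm_freeSymbol n t) _).trans
      ((Lp.fourierTransformₗᵢ (Space n) ℂ).norm_map f)

theorem free_apply {n : ℕ} (t : ℝ) (f : L2 n) :
    free t f = 𝓕⁻ (mulL2 (freeSymbolB n t) (𝓕 f : L2 n) : L2 n) := rfl

theorem freePropagator_eq_free {n : ℕ} (t : ℝ) (f : L2 n) : freePropagator t f = free t f := rfl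

theorem fourier_free {n : ℕ} (t : ℝ) (f : L2 n) :
    (𝓕 (free t f) : L2 n) = mulL2 (freeSymbolB n t) (𝓕 f : L2 n) := by
  rw [free_apply, FourierTransform.fourier_fourierInv_eq]

theorem free_add {n : ℕ} (s t : ℝ) (f : L2 n) : free (s + t) f = free s (free t f) := by
  rw [free_apply, free_apply, fourier_free, freeSymbolB_add, mulL2_mul]

theorem free_zero {n : ℕ} (f : L2 n) : free 0 f = f := by
  have h : mulL2 (freeSymbolB n 0) (𝓕 f : L2 n) = 𝓕 f := by
    refine Lp.ext ?_
    filter_upwards [coeFn_mulL2 (freeSymbolB n 0) (𝓕 f : L2 n)] with x hx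
    rw [hx, freeSymbolB_apply]
    simp [freeSymbol]
  rw [free_apply, h, FourierTransform.fourierInv_fourier_eq]

theorem free_neg_free {n : ℕ} (t : ℝ) (f : L2 n) : free (-t) (free t f) = f := by
  rw [← free_add, neg_add_cancel, free_zero]

theorem free_free_neg {n : ℕ} (t : ℝ) (f : L2 n) : free t (free (-t) f) = f := by
  rw [← free_add, add_neg_cancel, free_zero]

theorem mulL2_sub_left {n : ℕ} (v w : Space n →ᵇ ℂ) (g : L2 n) :
    mulL2 (v - w) g = mulL2 v g - mulL2 w g := by
  refine Lp.ext ?_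
  filter_upwards [coeFn_mulL2 (v - w) g, coeFn_mulL2 v g, coeFn_mulL2 w g,
    Lp.coeFn_sub (mulL2 v g) (mulL2 w g)] with x h1 h2 h3 h4
  rw [h1, h4, Pi.sub_apply, h2, h3, BoundedContinuousFunction.sub_apply, sub_mul]

theorem continuous_free {n : ℕ} (f : L2 n) : Continuous fun t : ℝ => free t f := by
  rw [continuous_iff_continuousAt]
  intro t
  have h : Tendsto (fun s => mulL2 (freeSymbolB n s - freeSymbolB n t) (𝓕 f : L2 n)) (𝓝 t)
      (𝓝 0) := by
    refine tendsto_mulL2_zero (C := 2) (fun s x => ?_) (fun x => ?_) _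
    · refine (norm_sub_le _ _).trans ?_
      rw [freeSymbolB_apply, freeSymbolB_apply, norm_freeSymbol, norm_freeSymbol]
      norm_num
    · have hc : Continuous fun s => freeSymbolB n s x - freeSymbolB n t x := by
        simp only [freeSymbolB_apply, freeSymbol]
        fun_prop
      simpa using hc.tendsto t
  rw [ContinuousAt, tendsto_iff_norm_sub_tendsto_zero]
  rw [tendsto_zero_iff_norm_tendsto_zero] at h
  refine h.congr fun s => ?_
  rw [mulL2_sub_left, ← fourier_free, ← fourier_free]
  have : (𝓕 (free s f) - 𝓕 (free t f) : L2 n) = 𝓕 (free s f - free t f) :=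
    ((Lp.fourierTransformₗᵢ (Space n) ℂ).map_sub _ _).symm
  rw [this, Lp.norm_fourier_eq]

theorem continuous_free_comp {n : ℕ} {X : Type*} [TopologicalSpace X] {φ : X → ℝ} {f : X → L2 n}
    (hφ : Continuous φ) (hf : Continuous f) : Continuous fun x => free (φ x) (f x) := by
  rw [continuous_iff_continuousAt]
  intro x₀
  rw [ContinuousAt, tendsto_iff_norm_sub_tendsto_zero]
  have h1 : Tendsto (fun x => ‖f x - f x₀‖ + ‖free (φ x) (f x₀) - free (φ x₀) (f x₀)‖)
      (𝓝 x₀) (𝓝 0) := by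
    have ha := (hf.sub (continuous_const (y := f x₀))).norm.tendsto x₀
    have hb := (((continuous_free (f x₀)).comp hφ).sub
      (continuous_const (y := free (φ x₀) (f x₀)))).norm.tendsto x₀
    simpa using ha.add hb
  refine squeeze_zero (fun _ => norm_nonneg _) (fun x => ?_) h1
  rw [← (free (φ x)).norm_map (f x - f x₀), map_sub]
  exact norm_sub_le_norm_sub_add_norm_sub _ _ _

/-- The potential `w` in the interaction picture, times `i`. -/
def interaction {n : ℕ} (w : Space n →ᵇ ℂ) (t : ℝ) : L2 n →L[ℂ] L2 n :=
  Complex.I • ((free (-t)).toContinuousLinearMap ∘L mulL2 w ∘L (free t).toContinuousLinearMap)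

theorem interaction_apply {n : ℕ} (w : Space n →ᵇ ℂ) (t : ℝ) (f : L2 n) :
    interaction w t f = Complex.I • free (-t) (mulL2 w (free t f)) := rfl

theorem norm_interaction_apply {n : ℕ} (w : Space n →ᵇ ℂ) (t : ℝ) (f : L2 n) :
    ‖interaction w t f‖ = ‖mulL2 w (free t f)‖ := by
  rw [interaction_apply, norm_smul, Complex.norm_I, one_mul, (free (-t)).norm_map]

theorem norm_interaction_le {n : ℕ} (w : Space n →ᵇ ℂ) (t : ℝ) : ‖interaction w t‖ ≤ ‖w‖ := by
  refine ContinuousLinearMap.opNorm_le_bound _ (norm_nonneg _) fun f => ?_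
  rw [norm_interaction_apply]
  refine ((mulL2 w).le_opNorm _).trans ?_
  rw [(free t).norm_map]
  exact mul_le_mul_of_nonneg_right (norm_mulL2_le w) (norm_nonneg _)

theorem continuous_interaction {n : ℕ} (w : Space n →ᵇ ℂ) (f : L2 n) :
    Continuous fun t => interaction w t f := by
  simp_rw [interaction_apply]
  exact (continuous_free_comp continuous_neg
    ((mulL2 w).continuous.comp (continuous_free f))).const_smul Complex.I

theorem inner_mulL2_left {n : ℕ} {w : Space n →ᵇ ℂ} (hw : ∀ x, (w x).im = 0) (f g : L2 n) :
    ⟪mulL2 w f, g⟫ = ⟪f, mulL2 w g⟫ := by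
  rw [L2.inner_def, L2.inner_def]
  refine integral_congr_ae ?_
  filter_upwards [coeFn_mulL2 w f, coeFn_mulL2 w g] with x h1 h2
  rw [h1, h2]
  have : (starRingEnd ℂ) (w x) = w x := Complex.conj_eq_iff_im.2 (hw x)
  simp [this]
  ring

theorem re_inner_interaction {n : ℕ} {w : Space n →ᵇ ℂ} (hw : ∀ x, (w x).im = 0) (t : ℝ)
    (f : L2 n) : (⟪f, interaction w t f⟫).re = 0 := by
  have h1 : ⟪f, interaction w t f⟫ = Complex.I * ⟪free t f, mulL2 w (free t f)⟫ := by
    rw [interaction_apply, inner_smul_right]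
    conv_lhs => rw [← free_neg_free t f]
    rw [(free (-t)).inner_map_map, free_free_neg]
  have h2 : (⟪free t f, mulL2 w (free t f)⟫).im = 0 := by
    rw [← Complex.conj_eq_iff_im, inner_conj_symm, inner_mulL2_left hw]
  rw [h1, Complex.mul_re, h2]
  simp

theorem norm_exp_sub_one_div_le (x : ℝ) :
    ‖(Complex.exp (-(Complex.I * x)) - 1) / x‖ ≤ 1 := by
  rw [norm_div, Complex.norm_real]
  refine div_le_one_of_le₀ ?_ (norm_nonneg _)
  have := Real.norm_exp_I_mul_ofReal_sub_one_le (x := -x)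
  simpa [mul_neg] using this

theorem tendsto_exp_sub_one_div :
    Tendsto (fun x : ℝ => (Complex.exp (-(Complex.I * x)) - 1) / x) (𝓝[≠] 0) (𝓝 (-Complex.I)) := by
  have h : HasDerivAt (fun x : ℝ => Complex.exp (-(Complex.I * x))) (-Complex.I) 0 := by
    have h1 : HasDerivAt (fun x : ℝ => -(Complex.I * (x : ℂ))) (-Complex.I) 0 := by
      simpa [Pi.neg_def] using
        ((Complex.ofRealCLM.hasDerivAt (x := (0 : ℝ))).const_mul Complex.I).neg
    simpa using h1.cexp
  rw [hasDerivAt_iff_tendsto_slope_zero] at h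
  refine h.congr fun x => ?_
  simp [div_eq_inv_mul]

theorem fourier_laplacian_apply {n : ℕ} (g : 𝓢(Space n, ℂ)) (ξ : Space n) :
    (𝓕 (Δ g)) ξ = (-(2 * Real.pi * ‖ξ‖) ^ 2 : ℝ) • (𝓕 g) ξ := by
  have hN : Function.HasTemperateGrowth (fun ξ : Space n => ‖ξ‖ ^ 2) := by fun_prop
  rw [SchwartzMap.laplacian_eq_fourierMultiplierCLM, SchwartzMap.fourierMultiplierCLM_apply,
    FourierTransform.fourier_smul, FourierTransform.fourier_fourierInv_eq, _root_.smul_apply,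
    SchwartzMap.smulLeftCLM_apply_apply hN, smul_smul]
  ring_nf

/-- The difference quotient of `t ↦ exp(-i t m)` at `0`, divided by `-m`, minus its limit. -/
def quotientSymbol (n : ℕ) {lam : ℝ} (hlam : 0 < lam) (h : ℝ) : Space n →ᵇ ℂ :=
  BoundedContinuousFunction.ofNormedAddCommGroup
    (fun ξ => -((Complex.exp (-(Complex.I * (h * ((2 * Real.pi * ‖ξ‖) ^ 2 + lam) : ℝ))) - 1)
      / (h * ((2 * Real.pi * ‖ξ‖) ^ 2 + lam) : ℝ)) - Complex.I)
    (by
      rcases eq_or_ne h 0 with rfl | hh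
      · simpa using continuous_const
      · refine ((Continuous.div (by fun_prop) (by fun_prop) fun ξ => ?_).neg).sub continuous_const
        have : 0 < (2 * Real.pi * ‖ξ‖) ^ 2 + lam := by positivity
        exact_mod_cast mul_ne_zero hh this.ne')
    2 fun ξ => by
      refine (norm_sub_le _ _).trans ?_
      rw [norm_neg, Complex.norm_I]
      linarith [norm_exp_sub_one_div_le (h * ((2 * Real.pi * ‖ξ‖) ^ 2 + lam))]

/-- A bound state, as a standing wave in the interaction picture. -/
def boundStateWave {n : ℕ} (lam : ℝ) (f : L2 n) (t : ℝ) : L2 n :=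
  Complex.exp (-(Complex.I * (lam * t : ℝ))) • free (-t) f

theorem boundStateWave_add {n : ℕ} (lam : ℝ) (f : L2 n) (s t : ℝ) :
    boundStateWave lam f (s + t)
      = Complex.exp (-(Complex.I * (lam * s : ℝ))) • free (-s) (boundStateWave lam f t) := by
  rw [boundStateWave, boundStateWave, map_smul, smul_smul, ← free_add, ← Complex.exp_add]
  congr 2
  · push_cast; ring_nf
  · ring_nf

theorem mulL2_quotientSymbol {n : ℕ} {lam : ℝ} (hlam : 0 < lam) {G K : L2 n}
    (hK : K =ᵐ[volume] fun ξ => -((2 * Real.pi * ‖ξ‖) ^ 2 + lam : ℝ) * G ξ) {h : ℝ} (hh : h ≠ 0) :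
    mulL2 (quotientSymbol n hlam h) K
      = (h : ℂ)⁻¹ • (Complex.exp (-(Complex.I * (lam * h : ℝ))) • mulL2 (freeSymbolB n (-h)) G - G)
        - Complex.I • K := by
  have hh' : (h : ℂ) ≠ 0 := by exact_mod_cast hh
  refine Lp.ext ?_
  generalize hP : mulL2 (freeSymbolB n (-h)) G = P
  have hP' : P =ᵐ[volume] fun ξ => freeSymbolB n (-h) ξ * G ξ := hP ▸ coeFn_mulL2 _ G
  set c := Complex.exp (-(Complex.I * (lam * h : ℝ))) with hc
  filter_upwards [hK, coeFn_mulL2 (quotientSymbol n hlam h) K,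
    hP', Lp.coeFn_sub ((h : ℂ)⁻¹ • (c • P - G))
      (Complex.I • K), Lp.coeFn_smul (h : ℂ)⁻¹ (c • P - G),
      Lp.coeFn_sub (c • P) G, Lp.coeFn_smul c P, Lp.coeFn_smul Complex.I K]
    with ξ h1 h2 h3 h4 h5 h6 h7 h8
  rw [h2, h4, Pi.sub_apply, h5, Pi.smul_apply, h6, Pi.sub_apply, h7, Pi.smul_apply, h3, h8,
    Pi.smul_apply, h1]
  have hm : (((2 * Real.pi * ‖ξ‖) ^ 2 + lam : ℝ) : ℂ) ≠ 0 := by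
    have : 0 < (2 * Real.pi * ‖ξ‖) ^ 2 + lam := by positivity
    exact_mod_cast this.ne'
  have hexp : c * freeSymbol n (-h) ξ
      = Complex.exp (-(Complex.I * (h * ((2 * Real.pi * ‖ξ‖) ^ 2 + lam) : ℝ))) := by
    simp only [c, freeSymbol]
    rw [← Complex.exp_add]
    push_cast
    ring_nf
  rw [freeSymbolB_apply, smul_eq_mul, smul_eq_mul, smul_eq_mul, ← mul_assoc c, hexp]
  change (-((_ - 1) / _) - Complex.I) * _ = _
  rw [Complex.ofReal_mul h]
  generalize (((2 * Real.pi * ‖ξ‖) ^ 2 + lam : ℝ) : ℂ) = m at *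
  field_simp
  ring

theorem tendsto_mulL2_quotientSymbol {n : ℕ} {lam : ℝ} (hlam : 0 < lam) (K : L2 n) :
    Tendsto (fun h => mulL2 (quotientSymbol n hlam h) K) (𝓝[≠] 0) (𝓝 0) := by
  refine tendsto_mulL2_zero (C := 2) (fun h ξ => ?_) (fun ξ => ?_) _
  · exact (BoundedContinuousFunction.norm_coe_le_norm _ _).trans
      (BoundedContinuousFunction.norm_ofNormedAddCommGroup_le _ zero_le_two _)
  · have hm : 0 < (2 * Real.pi * ‖ξ‖) ^ 2 + lam := by positivity
    have h1 : Tendsto (fun h : ℝ => h * ((2 * Real.pi * ‖ξ‖) ^ 2 + lam)) (𝓝[≠] 0) (𝓝[≠] 0) := by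
      refine tendsto_nhdsWithin_iff.2 ⟨?_, ?_⟩
      · have hc : Continuous fun h : ℝ => h * ((2 * Real.pi * ‖ξ‖) ^ 2 + lam) := by fun_prop
        simpa using (hc.tendsto 0).mono_left nhdsWithin_le_nhds
      · filter_upwards [self_mem_nhdsWithin] with h hh using mul_ne_zero hh hm.ne'
    have h2 := ((tendsto_exp_sub_one_div.comp h1).neg).sub_const Complex.I
    rw [neg_neg, sub_self] at h2
    exact h2

theorem mulL2_toLp_of_boundState {n : ℕ} {lam : ℝ} {w : Space n →ᵇ ℂ} {g : 𝓢(Space n, ℂ)}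
    (hg : ∀ x, -(Δ (g : Space n → ℂ)) x + w x * g x + lam * g x = 0) :
    mulL2 w (g.toLp 2) = (Δ g - (lam : ℂ) • g).toLp 2 := by
  refine Lp.ext ?_
  filter_upwards [coeFn_mulL2 w (g.toLp 2), g.coeFn_toLp 2 volume,
    (Δ g - (lam : ℂ) • g).coeFn_toLp 2 volume] with x h1 h2 h3
  rw [h1, h2, h3, _root_.sub_apply, _root_.smul_apply, SchwartzMap.laplacian_apply, smul_eq_mul]
  linear_combination hg x

theorem fourier_mulL2_toLp_of_boundState {n : ℕ} {lam : ℝ} {w : Space n →ᵇ ℂ}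
    {g : 𝓢(Space n, ℂ)}
    (hg : ∀ x, -(Δ (g : Space n → ℂ)) x + w x * g x + lam * g x = 0) :
    (𝓕 (mulL2 w (g.toLp 2)) : L2 n) =ᵐ[volume]
      fun ξ => -((2 * Real.pi * ‖ξ‖) ^ 2 + lam : ℝ) * (𝓕 (g.toLp 2) : L2 n) ξ := by
  rw [mulL2_toLp_of_boundState hg, SchwartzMap.toLp_fourier_eq, SchwartzMap.toLp_fourier_eq]
  have h0 : 𝓕 (Δ g - (lam : ℂ) • g) = 𝓕 (Δ g) - (lam : ℂ) • 𝓕 g := by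
    rw [← FourierTransform.fourier_smul]
    exact map_sub (FourierTransform.fourierCLM ℂ 𝓢(Space n, ℂ)) _ _
  filter_upwards [(𝓕 g).coeFn_toLp 2 volume,
    (𝓕 (Δ g - (lam : ℂ) • g)).coeFn_toLp 2 volume] with ξ h1 h2
  rw [h1, h2, h0, _root_.sub_apply, _root_.smul_apply, fourier_laplacian_apply, smul_eq_mul,
    Complex.real_smul]
  push_cast
  ring

theorem hasDerivAt_boundStateWave_zero {n : ℕ} {lam : ℝ} (hlam : 0 < lam) {f K : L2 n}
    (hK : (𝓕 K : L2 n) =ᵐ[volume]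
      fun ξ => -((2 * Real.pi * ‖ξ‖) ^ 2 + lam : ℝ) * (𝓕 f : L2 n) ξ) :
    HasDerivAt (boundStateWave lam f) (Complex.I • K) 0 := by
  rw [hasDerivAt_iff_tendsto_slope_zero, tendsto_iff_norm_sub_tendsto_zero]
  have hlim := tendsto_mulL2_quotientSymbol hlam (𝓕 K : L2 n)
  rw [tendsto_zero_iff_norm_tendsto_zero] at hlim
  refine hlim.congr' ?_
  filter_upwards [self_mem_nhdsWithin] with h hh
  rw [← (Lp.fourierTransformₗᵢ (Space n) ℂ).norm_map (_ - _), mulL2_quotientSymbol hlam hK hh,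
    ← fourier_free]
  have e2 : h⁻¹ • (boundStateWave lam f (0 + h) - boundStateWave lam f 0)
      = (h : ℂ)⁻¹ • (Complex.exp (-(Complex.I * (lam * h : ℝ))) • free (-h) f - f) := by
    simp only [boundStateWave, zero_add, mul_zero, Complex.ofReal_zero, neg_zero,
      Complex.exp_zero, free_zero, one_smul]
    rw [← Complex.ofReal_inv, Complex.coe_smul]
    rfl
  rw [e2, map_sub, map_smul, map_smul, map_sub, map_smul]
  rfl

/-- The standing wave of a bound state solves the equation in the interaction picture. -/
theorem hasDerivAt_boundStateWave {n : ℕ} {lam : ℝ} (hlam : 0 < lam) {w : Space n →ᵇ ℂ}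
    {g : 𝓢(Space n, ℂ)}
    (hg : ∀ x, -(Δ (g : Space n → ℂ)) x + w x * g x + lam * g x = 0) (t : ℝ) :
    HasDerivAt (boundStateWave lam (g.toLp 2))
      (interaction w t (boundStateWave lam (g.toLp 2) t)) t := by
  have h0 := hasDerivAt_boundStateWave_zero hlam (fourier_mulL2_toLp_of_boundState hg)
  generalize g.toLp 2 = f at h0 ⊢
  have h1 : HasDerivAt (fun s => boundStateWave lam f (t + s))
      (interaction w t (boundStateWave lam f t)) 0 := by
    have h2 := (((free (-t)).toContinuousLinearMap.restrictScalars ℝ).hasFDerivAt.comp_hasDerivAt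
      (0 : ℝ) h0).const_smul (Complex.exp (-(Complex.I * (lam * t : ℝ))))
    have h3 : interaction w t (boundStateWave lam f t) =
        Complex.exp (-(Complex.I * (lam * t : ℝ))) • free (-t) (Complex.I • mulL2 w f) := by
      rw [interaction_apply, boundStateWave, map_smul, free_free_neg, map_smul, map_smul,
        map_smul, smul_comm]
    rw [h3, show (fun s => boundStateWave lam f (t + s)) = fun s =>
      Complex.exp (-(Complex.I * (lam * t : ℝ))) • free (-t) (boundStateWave lam f s) from
      funext fun s => boundStateWave_add lam f t s]
    exact h2
  have h4 := HasDerivAt.comp_sub_const (f := fun s => boundStateWave lam f (t + s)) t t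
    (by simpa using h1)
  simpa using h4

section LinearODE

variable {E : Type*} [NormedAddCommGroup E] [InnerProductSpace ℂ E]

/-- A strongly continuous, uniformly bounded family of skew-adjoint operators. -/
structure IsSkewFamily (B : ℝ → E →L[ℂ] E) (M : ℝ≥0) : Prop where
  continuous_apply : ∀ x, Continuous fun t => B t x
  norm_le : ∀ t, ‖B t‖ ≤ M
  re_inner : ∀ t x, (⟪x, B t x⟫).re = 0

namespace IsSkewFamily

variable {B : ℝ → E →L[ℂ] E} {M : ℝ≥0}

theorem norm_apply_le (hB : IsSkewFamily B M) (t : ℝ) (x : E) : ‖B t x‖ ≤ M * ‖x‖ :=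
  ((B t).le_opNorm x).trans (mul_le_mul_of_nonneg_right (hB.norm_le t) (norm_nonneg _))

theorem continuous_comp (hB : IsSkewFamily B M) {a : ℝ → E} (ha : Continuous a) :
    Continuous fun t => B t (a t) := by
  rw [continuous_iff_continuousAt]
  intro s
  rw [ContinuousAt, tendsto_iff_norm_sub_tendsto_zero]
  have h1 : Tendsto (fun t => M * ‖a t - a s‖ + ‖B t (a s) - B s (a s)‖) (𝓝 s) (𝓝 0) := by
    have ha' := (((ha.sub (continuous_const (y := a s))).norm).const_mul (M : ℝ)).tendsto s
    have hb := ((hB.continuous_apply (a s)).sub (continuous_const (y := B s (a s)))).norm.tendsto s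
    simpa using ha'.add hb
  refine squeeze_zero (fun _ => norm_nonneg _) (fun t => ?_) h1
  refine (norm_sub_le_norm_sub_add_norm_sub _ (B t (a s)) _).trans ?_
  rw [← map_sub]
  gcongr
  exact hB.norm_apply_le _ _

theorem norm_eq (hB : IsSkewFamily B M) {a : ℝ → E} (ha : ∀ t, HasDerivAt a (B t (a t)) t)
    (s t : ℝ) : ‖a s‖ = ‖a t‖ := by
  have h1 : ∀ t, HasDerivAt (fun t => ⟪a t, a t⟫) 0 t := by
    intro t
    have h2 := (ha t).inner ℂ (ha t)
    have h3 : ⟪a t, B t (a t)⟫ + ⟪B t (a t), a t⟫ = 0 := by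
      rw [← inner_conj_symm (B t (a t)) (a t), Complex.add_conj, hB.re_inner]
      simp
    rwa [h3] at h2
  have h4 := is_const_of_deriv_eq_zero (fun t => (h1 t).differentiableAt)
    (fun t => (h1 t).deriv) s t
  simp only [inner_self_eq_norm_sq_to_K] at h4
  have h5 : ‖a s‖ ^ 2 = ‖a t‖ ^ 2 := by exact_mod_cast h4
  exact (sq_eq_sq₀ (norm_nonneg _) (norm_nonneg _)).1 h5

theorem eq_of_eq (hB : IsSkewFamily B M) {a b : ℝ → E} (ha : ∀ t, HasDerivAt a (B t (a t)) t)
    (hb : ∀ t, HasDerivAt b (B t (b t)) t) {s : ℝ} (h : a s = b s) : a = b := by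
  ext t
  have hab : ∀ t, HasDerivAt (a - b) (B t ((a - b) t)) t := fun t => by
    rw [Pi.sub_apply, map_sub]
    exact (ha t).sub (hb t)
  have := hB.norm_eq hab t s
  rw [Pi.sub_apply, Pi.sub_apply, h, sub_self, norm_zero, norm_eq_zero] at this
  exact sub_eq_zero.1 this

theorem norm_integral_cosh_le (hB : IsSkewFamily B M) {b : ℝ → E} {C κ : ℝ} (hκ : 0 < κ)
    (hbC : ∀ t, ‖b t‖ ≤ C) (s t : ℝ) :
    ‖∫ τ in s..t, B τ (Real.cosh (κ * (τ - s)) • b τ)‖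
      ≤ M * C / κ * Real.cosh (κ * (t - s)) := by
  have hC : 0 ≤ C := (norm_nonneg _).trans (hbC 0)
  have h1 : ‖∫ τ in s..t, B τ (Real.cosh (κ * (τ - s)) • b τ)‖
      ≤ |∫ τ in s..t, M * C * Real.cosh (κ * (τ - s))| := by
    refine intervalIntegral.norm_integral_le_abs_of_norm_le
      (Eventually.of_forall fun τ => ?_) (Continuous.intervalIntegrable (by fun_prop) _ _)
    refine (hB.norm_apply_le _ _).trans ?_
    rw [norm_smul, Real.norm_eq_abs, abs_of_pos (Real.cosh_pos _)]
    calc (M : ℝ) * (Real.cosh (κ * (τ - s)) * ‖b τ‖)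
        ≤ M * (Real.cosh (κ * (τ - s)) * C) := by
          have := (Real.cosh_pos (κ * (τ - s))).le
          gcongr
          exact hbC τ
      _ = _ := by ring
  have h2 : ∫ τ in s..t, M * C * Real.cosh (κ * (τ - s))
      = M * C / κ * Real.sinh (κ * (t - s)) := by
    have hd : ∀ τ ∈ Set.uIcc s t, HasDerivAt (fun τ => M * C / κ * Real.sinh (κ * (τ - s)))
        (M * C * Real.cosh (κ * (τ - s))) τ := by
      intro τ _
      have := ((((hasDerivAt_id τ).sub_const s).const_mul κ).sinh).const_mul (M * C / κ)
      convert! this using 1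
      simp
      field_simp
    rw [intervalIntegral.integral_eq_sub_of_hasDerivAt hd
      (Continuous.intervalIntegrable (by fun_prop) _ _)]
    simp
  rw [h2, abs_mul, abs_of_nonneg (by positivity)] at h1
  refine h1.trans (mul_le_mul_of_nonneg_left ?_ (by positivity))
  rw [Real.abs_sinh, ← Real.cosh_abs]
  exact (Real.sinh_lt_cosh _).le

variable [CompleteSpace E]

/-- Global solvability of `a' = B(t) a`. -/
theorem exists_hasDerivAt (hB : IsSkewFamily B M) (s : ℝ) (x : E) :
    ∃ a : ℝ → E, a s = x ∧ ∀ t, HasDerivAt a (B t (a t)) t := by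
  set κ : ℝ := 2 * M + 1 with hκ
  have hκ0 : 0 < κ := by positivity
  let φ : ℝ → ℝ := fun t => Real.cosh (κ * (t - s))
  have hφc : Continuous φ := by fun_prop
  have hφ1 : ∀ t, 1 ≤ φ t := fun t => Real.one_le_cosh _
  have hφ0 : ∀ t, 0 < φ t := fun t => Real.cosh_pos _
  have hBc : ∀ b : ℝ →ᵇ E, Continuous fun τ => B τ (φ τ • b τ) := fun b =>
    hB.continuous_comp (hφc.smul b.continuous)
  have hI : ∀ b : ℝ →ᵇ E, ∀ t u, IntervalIntegrable (fun τ => B τ (φ τ • b τ)) volume t u :=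
    fun b t u => (hBc b).intervalIntegrable _ _
  have hbd : ∀ (b : ℝ →ᵇ E) t, ‖(φ t)⁻¹ • (∫ τ in s..t, B τ (φ τ • b τ))‖ ≤ M * ‖b‖ / κ := by
    intro b t
    rw [norm_smul, norm_inv, Real.norm_eq_abs, abs_of_pos (hφ0 t), inv_mul_le_iff₀ (hφ0 t),
      mul_comm (φ t)]
    exact hB.norm_integral_cosh_le hκ0 b.norm_coe_le_norm s t
  let Φ : (ℝ →ᵇ E) → (ℝ →ᵇ E) := fun b => BoundedContinuousFunction.ofNormedAddCommGroup
    (fun t => (φ t)⁻¹ • (x + ∫ τ in s..t, B τ (φ τ • b τ)))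
    ((hφc.inv₀ fun t => (hφ0 t).ne').smul
      (continuous_const.add (intervalIntegral.continuous_primitive (hI b) s)))
    (‖x‖ + M * ‖b‖ / κ) (fun t => by
      rw [smul_add]
      refine (norm_add_le _ _).trans (add_le_add ?_ (hbd b t))
      rw [norm_smul, norm_inv, Real.norm_eq_abs, abs_of_pos (hφ0 t)]
      exact mul_le_of_le_one_left (norm_nonneg _) (inv_le_one_of_one_le₀ (hφ1 t)))
  have hΦa : ∀ b t, Φ b t = (φ t)⁻¹ • (x + ∫ τ in s..t, B τ (φ τ • b τ)) := fun _ _ => rfl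
  have hΦ : ContractingWith (1 / 2) Φ := by
    refine ⟨by rw [← NNReal.coe_lt_coe]; norm_num, LipschitzWith.of_dist_le_mul fun b c => ?_⟩
    rw [BoundedContinuousFunction.dist_le (by positivity)]
    intro t
    have h1 : Φ b t - Φ c t = (φ t)⁻¹ • (∫ τ in s..t, B τ (φ τ • (b - c) τ)) := by
      rw [hΦa, hΦa, ← smul_sub, add_sub_add_left_eq_sub,
        ← intervalIntegral.integral_sub (hI b _ _) (hI c _ _)]
      simp only [BoundedContinuousFunction.coe_sub, Pi.sub_apply, smul_sub, map_sub]
    rw [dist_eq_norm, h1, dist_eq_norm]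
    refine (hbd (b - c) t).trans ?_
    rw [div_le_iff₀ hκ0, hκ]
    push_cast
    nlinarith [norm_nonneg (b - c), M.coe_nonneg]
  obtain ⟨b, hb⟩ : ∃ b, Φ b = b := ⟨_, hΦ.fixedPoint_isFixedPt⟩
  have ha : ∀ t, φ t • b t = x + ∫ τ in s..t, B τ (φ τ • b τ) := by
    intro t
    have h1 : b t = (φ t)⁻¹ • (x + ∫ τ in s..t, B τ (φ τ • b τ)) := by rw [← hΦa, hb]
    conv_lhs => rw [h1]
    rw [smul_smul, mul_inv_cancel₀ (hφ0 t).ne', one_smul]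
  refine ⟨fun t => φ t • b t, by simp [ha s], fun t => ?_⟩
  have h2 := ((hBc b).integral_hasStrictDerivAt s t).hasDerivAt.const_add x
  exact h2.congr_of_eventuallyEq (Eventually.of_forall ha)

/-- The solution of `a' = B(t) a`, `a(s) = x`. -/
def evol (hB : IsSkewFamily B M) (s : ℝ) (x : E) : ℝ → E := (hB.exists_hasDerivAt s x).choose

theorem evol_self (hB : IsSkewFamily B M) (s : ℝ) (x : E) : hB.evol s x s = x :=
  (hB.exists_hasDerivAt s x).choose_spec.1

theorem hasDerivAt_evol (hB : IsSkewFamily B M) (s : ℝ) (x : E) (t : ℝ) :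
    HasDerivAt (hB.evol s x) (B t (hB.evol s x t)) t :=
  (hB.exists_hasDerivAt s x).choose_spec.2 t

theorem continuous_evol (hB : IsSkewFamily B M) (s : ℝ) (x : E) : Continuous (hB.evol s x) :=
  continuous_iff_continuousAt.2 fun t => (hB.hasDerivAt_evol s x t).continuousAt

theorem norm_evol (hB : IsSkewFamily B M) (s : ℝ) (x : E) (t : ℝ) : ‖hB.evol s x t‖ = ‖x‖ := by
  rw [hB.norm_eq (hB.hasDerivAt_evol s x) t s, hB.evol_self]

theorem evol_eq (hB : IsSkewFamily B M) {a : ℝ → E} (ha : ∀ t, HasDerivAt a (B t (a t)) t) (s : ℝ) :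
    hB.evol s (a s) = a :=
  hB.eq_of_eq (hB.hasDerivAt_evol _ _) ha (hB.evol_self _ _)

/-- The solution operator from time `s` to time `t`. -/
def flow (hB : IsSkewFamily B M) (s t : ℝ) : E ≃ E where
  toFun x := hB.evol s x t
  invFun y := hB.evol t y s
  left_inv x := by beta_reduce; rw [hB.evol_eq (hB.hasDerivAt_evol s x), hB.evol_self]
  right_inv y := by beta_reduce; rw [hB.evol_eq (hB.hasDerivAt_evol t y), hB.evol_self]

/-- If `B(τ)` is small on the initial value, it stays small on the solution. -/
theorem norm_apply_evol_le (hB : IsSkewFamily B M) {s t δ : ℝ} (hδ : 0 ≤ δ) {x : E}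
    (hx : ∀ τ ∈ Set.Icc s t, ‖B τ x‖ ≤ δ) {τ : ℝ} (hτ : τ ∈ Set.Icc s t) :
    ‖B τ (hB.evol s x τ)‖ ≤ δ * Real.exp ((M + 1) * (t - s)) := by
  have hM : (M : ℝ) + 1 ≠ 0 := by positivity
  have hBe : ∀ τ ∈ Set.Icc s t, ‖B τ (hB.evol s x τ)‖ ≤ (M + 1) * ‖hB.evol s x τ - x‖ + δ := by
    intro τ hτ
    have : B τ (hB.evol s x τ) = B τ (hB.evol s x τ - x) + B τ x := by rw [map_sub]; abel
    rw [this]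
    refine (norm_add_le _ _).trans (add_le_add ?_ (hx τ hτ))
    refine (hB.norm_apply_le _ _).trans ?_
    gcongr
    linarith
  have h1 := norm_le_gronwallBound_of_norm_deriv_right_le
    (f := fun τ => hB.evol s x τ - x) (f' := fun τ => B τ (hB.evol s x τ)) (δ := 0)
    (K := M + 1) (ε := δ) (a := s) (b := t)
    ((hB.continuous_evol s x).sub continuous_const).continuousOn
    (fun τ _ => ((hB.hasDerivAt_evol s x τ).sub_const x).hasDerivWithinAt)
    (by simp [hB.evol_self]) (fun τ hτ => hBe τ (Set.Ico_subset_Icc_self hτ)) τ hτ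
  rw [gronwallBound_of_K_ne_0 hM] at h1
  refine (hBe τ hτ).trans ?_
  calc (M + 1) * ‖hB.evol s x τ - x‖ + δ
      ≤ (M + 1) * (0 * Real.exp ((M + 1) * (τ - s))
          + δ / (M + 1) * (Real.exp ((M + 1) * (τ - s)) - 1)) + δ := by gcongr
    _ = δ * Real.exp ((M + 1) * (τ - s)) := by field_simp; ring
    _ ≤ _ := by
      gcongr
      exact hτ.2

end IsSkewFamily

end LinearODE

section Concatenation

open scoped Classical in
/-- The function that is `F j` on `[t j, t (j + 1))` and zero elsewhere. -/
def piecewiseIco {α : Type*} [Zero α] (t : ℕ → ℝ) (F : ℕ → ℝ → α) (τ : ℝ) : α :=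
  if h : ∃ j, τ ∈ Set.Ico (t j) (t (j + 1)) then F (Nat.find h) τ else 0

theorem eq_of_mem_Ico_succ {t : ℕ → ℝ} (ht : Monotone t) {τ : ℝ} {i j : ℕ}
    (hi : τ ∈ Set.Ico (t i) (t (i + 1))) (hj : τ ∈ Set.Ico (t j) (t (j + 1))) : i = j := by
  rcases lt_trichotomy i j with h | h | h
  · exact absurd (hi.2.trans_le ((ht h).trans hj.1)) (lt_irrefl _)
  · exact h
  · exact absurd (hj.2.trans_le ((ht h).trans hi.1)) (lt_irrefl _)

theorem piecewiseIco_of_mem {α : Type*} [Zero α] {t : ℕ → ℝ} (ht : Monotone t) (F : ℕ → ℝ → α)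
    {τ : ℝ} {j : ℕ} (hj : τ ∈ Set.Ico (t j) (t (j + 1))) : piecewiseIco t F τ = F j τ := by
  classical
  have h : ∃ j, τ ∈ Set.Ico (t j) (t (j + 1)) := ⟨j, hj⟩
  rw [piecewiseIco, dif_pos h, eq_of_mem_Ico_succ ht (Nat.find_spec h) hj]

theorem piecewiseIco_of_notMem {α : Type*} [Zero α] {t : ℕ → ℝ} (F : ℕ → ℝ → α)
    {τ : ℝ} (h : ∀ j, τ ∉ Set.Ico (t j) (t (j + 1))) : piecewiseIco t F τ = 0 := by
  rw [piecewiseIco, dif_neg]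
  push Not
  exact h

variable {E : Type*} [NormedAddCommGroup E]

theorem integrable_piecewiseIco [NormedSpace ℝ E] {t : ℕ → ℝ} (ht : Monotone t) {F : ℕ → ℝ → E}
    (hF : ∀ j, Continuous (F j)) {k : ℕ}
    (h : ∀ j, k < j → ∫ τ in Set.Ico (t j) (t (j + 1)), ‖F j τ‖ ≤ (1 / 2) ^ j) :
    Integrable (piecewiseIco t F) := by
  have hU : IntegrableOn (piecewiseIco t F) (⋃ j, Set.Ico (t j) (t (j + 1))) := by
    refine integrableOn_iUnion_of_summable_integral_norm (fun j => ?_) ?_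
    · refine IntegrableOn.congr_fun ?_ (fun τ hτ => (piecewiseIco_of_mem ht F hτ).symm)
        measurableSet_Ico
      exact ((hF j).continuousOn.integrableOn_Icc).mono_set Set.Ico_subset_Icc_self
    · refine Summable.of_norm_bounded_eventually_nat (summable_geometric_two) ?_
      filter_upwards [eventually_gt_atTop k] with j hj
      rw [Real.norm_of_nonneg (integral_nonneg fun _ => norm_nonneg _)]
      refine le_trans (le_of_eq ?_) (h j hj)
      exact setIntegral_congr_fun measurableSet_Ico
        fun τ hτ => by rw [piecewiseIco_of_mem ht F hτ]
  refine hU.integrable_of_forall_notMem_eq_zero fun τ hτ => piecewiseIco_of_notMem F fun j hj => ?_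
  exact hτ (Set.mem_iUnion.2 ⟨j, hj⟩)

variable [InnerProductSpace ℂ E] [CompleteSpace E]

/-- Concatenation of evolutions along infinitely many time intervals. If each generator can be
chosen arbitrarily small on any given vector, then the choices can be made so that prescribed
solutions on the individual intervals extend to global ones with an integrable derivative. -/
theorem exists_concatenation {t : ℕ → ℝ} (ht0 : t 0 = 0) (ht : Monotone t)
    {B : ℕ → ℕ → ℝ → E →L[ℂ] E} {M : ℕ → ℝ≥0} (hB : ∀ j m, IsSkewFamily (B j m) (M j))
    (hsmall : ∀ j x, ∀ δ > 0, ∀ᶠ m in atTop, ∀ τ ∈ Set.Icc (t j) (t (j + 1)), ‖B j m τ x‖ ≤ δ)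
    {φ : ℕ → ℕ → ℝ → E} (hφ : ∀ j m τ, HasDerivAt (φ j m) (B j m τ (φ j m τ)) τ) :
    ∃ (m : ℕ → ℕ) (a G : ℕ → ℝ → E), ∀ k,
      Continuous (a k) ∧ Integrable (G k) ∧ (∀ τ, a k τ = a k 0 + ∫ σ in (0 : ℝ)..τ, G k σ) ∧
      (∀ j, ∀ τ ∈ Set.Ico (t j) (t (j + 1)), G k τ = B j (m j) τ (a k τ)) ∧
      (∀ τ, (∀ j, τ ∉ Set.Ico (t j) (t (j + 1))) → G k τ = 0) ∧
      (∀ τ ∈ Set.Icc (t k) (t (k + 1)), a k τ = φ k (m k) τ) ∧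
      ‖a k 0‖ = ‖φ k (m k) (t k)‖ := by
  have hδ : ∀ j, ∃ δ : ℝ, 0 < δ ∧
      (t (j + 1) - t j) * (δ * Real.exp ((M j + 1) * (t (j + 1) - t j))) ≤ (1 / 2) ^ j := by
    intro j
    have hl : 0 ≤ t (j + 1) - t j := sub_nonneg.2 (ht j.le_succ)
    set e := Real.exp ((M j + 1) * (t (j + 1) - t j))
    have he : 0 < e := Real.exp_pos _
    refine ⟨(1 / 2) ^ j / ((t (j + 1) - t j + 1) * e), by positivity, ?_⟩
    field_simp
    linarith
  choose δ hδ using hδ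
  have hpick : ∀ (j : ℕ) (s : (E ≃ E) × (ℕ → E)), ∃ m, ∀ i ∈ Finset.range j,
      ∀ τ ∈ Set.Icc (t j) (t (j + 1)), ‖B j m τ (s.1 (s.2 i))‖ ≤ δ j := fun j s =>
    ((Filter.eventually_all_finset (Finset.range j)).2 fun i _ =>
      hsmall j (s.1 (s.2 i)) (δ j) (hδ j).1).exists
  choose pick hpick using hpick
  let step : ℕ → (E ≃ E) × (ℕ → E) → (E ≃ E) × (ℕ → E) := fun j s =>
    (s.1.trans ((hB j (pick j s)).flow (t j) (t (j + 1))),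
      Function.update s.2 j (s.1.symm (φ j (pick j s) (t j))))
  let S : ℕ → (E ≃ E) × (ℕ → E) := fun j => Nat.rec (Equiv.refl E, fun _ => 0) step j
  have hS : ∀ j, S (j + 1) = step j (S j) := fun j => rfl
  let m : ℕ → ℕ := fun j => pick j (S j)
  let P : ℕ → E ≃ E := fun j => (S j).1
  let x : ℕ → E := fun i => (S (i + 1)).2 i
  have hP : ∀ j y, P (j + 1) y = (hB j (m j)).evol (t j) (P j y) (t (j + 1)) := fun j y => rfl
  have hPx : ∀ k, P k (x k) = φ k (m k) (t k) := by
    intro k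
    change (S k).1 ((step k (S k)).2 k) = _
    simp [step, m]
  have hx : ∀ i j, i < j → (S j).2 i = x i := by
    intro i j hij
    induction j, hij using Nat.le_induction with
    | base => rfl
    | succ j hj ih =>
      rw [hS, ← ih]
      exact Function.update_of_ne (Nat.lt_of_succ_le hj).ne _ _
  have hPnorm : ∀ j y, ‖P j y‖ = ‖y‖ := by
    intro j y
    induction j with
    | zero => rfl
    | succ j ih => rw [hP, (hB j (m j)).norm_evol, ih]
  let F : ℕ → ℕ → ℝ → E := fun k j τ =>
    B j (m j) τ ((hB j (m j)).evol (t j) (P j (x k)) τ)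
  have hFc : ∀ k j, Continuous (F k j) := fun k j =>
    (hB j (m j)).continuous_comp ((hB j (m j)).continuous_evol _ _)
  let G : ℕ → ℝ → E := fun k => piecewiseIco t (F k)
  have hG : ∀ k, Integrable (G k) := by
    intro k
    refine integrable_piecewiseIco ht (hFc k) (k := k) fun j hj => ?_
    have hb : ∀ τ ∈ Set.Ico (t j) (t (j + 1)),
        ‖F k j τ‖ ≤ δ j * Real.exp ((M j + 1) * (t (j + 1) - t j)) := fun τ hτ =>
      (hB j (m j)).norm_apply_evol_le (hδ j).1.le
        (fun σ hσ => by
          have := hpick j (S j) k (Finset.mem_range.2 hj) σ hσ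
          rwa [hx k j hj] at this) (Set.Ico_subset_Icc_self hτ)
    refine le_trans ?_ (hδ j).2
    have h1 := norm_setIntegral_le_of_norm_le_const (μ := volume) (f := fun τ => ‖F k j τ‖)
      (s := Set.Ico (t j) (t (j + 1))) (by simp) (fun τ hτ => by simpa using hb τ hτ)
    refine (Real.le_norm_self _).trans (h1.trans (le_of_eq ?_))
    rw [Real.volume_real_Ico_of_le (ht j.le_succ), mul_comm]
  let a : ℕ → ℝ → E := fun k τ => x k + ∫ σ in (0 : ℝ)..τ, G k σ
  have ha_add : ∀ k s τ, a k τ = a k s + ∫ σ in s..τ, G k σ := by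
    intro k s τ
    simp only [a]
    rw [add_assoc, intervalIntegral.integral_add_adjacent_intervals
      (hG k).intervalIntegrable (hG k).intervalIntegrable]
  have hpiece : ∀ k j, a k (t j) = P j (x k) → ∀ τ ∈ Set.Icc (t j) (t (j + 1)),
      a k τ = (hB j (m j)).evol (t j) (P j (x k)) τ := by
    intro k j hj τ hτ
    have h1 : ∫ σ in t j..τ, G k σ = ∫ σ in t j..τ, F k j σ :=
      intervalIntegral.integral_congr_Ioo_of_le hτ.1 fun σ hσ =>
        piecewiseIco_of_mem ht (F k) ⟨hσ.1.le, hσ.2.trans_le hτ.2⟩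
    rw [ha_add k (t j), h1, intervalIntegral.integral_eq_sub_of_hasDerivAt
      (fun σ _ => (hB j (m j)).hasDerivAt_evol (t j) (P j (x k)) σ)
      ((hFc k j).intervalIntegrable _ _), hj, (hB j (m j)).evol_self]
    abel
  have hnode : ∀ k j, a k (t j) = P j (x k) := by
    intro k j
    induction j with
    | zero => simp [a, ht0]; rfl
    | succ j ih => exact hpiece k j ih _ ⟨ht j.le_succ, le_rfl⟩
  refine ⟨m, a, G, fun k => ⟨?_, hG k, fun τ => ha_add k 0 τ, fun j τ hτ => ?_,
    fun τ hτ => piecewiseIco_of_notMem _ hτ, fun τ hτ => ?_, ?_⟩⟩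
  · exact continuous_const.add (intervalIntegral.continuous_primitive
      (fun _ _ => (hG k).intervalIntegrable) 0)
  · rw [hpiece k j (hnode k j) τ (Set.Ico_subset_Icc_self hτ)]
    exact piecewiseIco_of_mem ht (F k) hτ
  · rw [hpiece k k (hnode k k) τ hτ, hPx, (hB k (m k)).evol_eq (hφ k (m k))]
  · rw [← hPx, hPnorm]
    simp [a]

end Concatenation

theorem IsSolution.mono {n : ℕ} {I J : Set ℝ} {V : ℝ → Space n → ℝ} {u : ℝ → L2 n}
    (h : IsSolution I V u) (hJ : J ⊆ I) : IsSolution J V u := by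
  obtain ⟨G, hG, hd⟩ := h.duhamel
  exact ⟨h.continuousOn.mono hJ, G, ae_restrict_of_ae_restrict_of_subset hJ hG,
    fun t ht => hd t (hJ ht)⟩

/-- Solutions of the equation in the interaction picture give solutions of the equation. -/
theorem isSolution_of_interaction {n : ℕ} {I : Set ℝ} {V : ℝ → Space n → ℝ} {a G : ℝ → L2 n}
    (ha : Continuous a) (hG : ∀ t, IntervalIntegrable G volume 0 t)
    (haG : ∀ t, a t = a 0 + ∫ τ in (0 : ℝ)..t, G τ)
    (hV : ∀ᵐ τ ∂(volume.restrict I), ((-Complex.I) • free τ (G τ) : L2 n)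
      =ᵐ[volume] fun x => (V τ x : ℂ) * free τ (a τ) x) :
    IsSolution I V fun t => free t (a t) := by
  refine ⟨(continuous_free_comp continuous_id ha).continuousOn,
    fun τ => (-Complex.I) • free τ (G τ), hV, fun t _ => ?_⟩
  have h1 : ∀ τ, freePropagator (t - τ) ((-Complex.I) • free τ (G τ))
      = (-Complex.I) • free t (G τ) := fun τ => by
    rw [freePropagator_eq_free, map_smul, ← free_add, sub_add_cancel]
  simp_rw [h1]
  have h2 : IntervalIntegrable (fun τ => free t (G τ)) volume 0 t :=
    ⟨(free t).toContinuousLinearMap.integrable_comp (hG t).1,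
      (free t).toContinuousLinearMap.integrable_comp (hG t).2⟩
  refine ⟨h2.smul (-Complex.I), ?_⟩
  rw [intervalIntegral.integral_smul, smul_smul, freePropagator_eq_free, free_zero, haG t, map_add]
  have h3 : ∫ τ in (0 : ℝ)..t, free t (G τ) = free t (∫ τ in (0 : ℝ)..t, G τ) :=
    (free t).toContinuousLinearMap.intervalIntegral_comp_comm (hG t)
  rw [h3]
  simp

/-- The function `x ↦ f((x - c)/ε)`. -/
def rescale {n : ℕ} {F : Type*} (ε : ℝ) (c : Space n) (f : Space n → F) (x : Space n) : F :=
  f (ε⁻¹ • (x - c))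

/-- The rescaled potential `ε⁻² W((x - c)/ε)`. -/
def scaledPotential {n : ℕ} (W : Space n → ℝ) (ε : ℝ) (c x : Space n) : ℝ :=
  ε⁻¹ ^ 2 * rescale ε c W x

/-- A continuous compactly supported potential, rescaled, as a bounded continuous function. -/
def scaledPotentialB {n : ℕ} {W : Space n → ℝ} (hW : Continuous W) (hWs : HasCompactSupport W)
    (ε : ℝ) (c : Space n) : Space n →ᵇ ℂ :=
  BoundedContinuousFunction.ofNormedAddCommGroup (fun x => (scaledPotential W ε c x : ℂ))
    (by unfold scaledPotential rescale; fun_prop)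
    (ε⁻¹ ^ 2 * (hW.bounded_above_of_compact_support hWs).choose) fun x => by
      rw [scaledPotential, Complex.norm_real, norm_mul, norm_pow, norm_inv, Real.norm_eq_abs ε,
        ← abs_inv, sq_abs]
      gcongr
      exact (hW.bounded_above_of_compact_support hWs).choose_spec _

theorem norm_scaledPotentialB_le {n : ℕ} {W : Space n → ℝ} (hW : Continuous W)
    (hWs : HasCompactSupport W) (ε : ℝ) : ∃ C : ℝ≥0, ∀ c, ‖scaledPotentialB hW hWs ε c‖ ≤ C := by
  set C := (hW.bounded_above_of_compact_support hWs).choose with hCdef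
  have hC : 0 ≤ C :=
    (norm_nonneg _).trans ((hW.bounded_above_of_compact_support hWs).choose_spec 0)
  refine ⟨(ε⁻¹ ^ 2 * C).toNNReal, fun c => ?_⟩
  rw [Real.coe_toNNReal _ (by positivity)]
  exact BoundedContinuousFunction.norm_ofNormedAddCommGroup_le _ (by positivity) _

theorem isSkewFamily_interaction {n : ℕ} {w : Space n →ᵇ ℂ} (hw : ∀ x, (w x).im = 0) {M : ℝ≥0}
    (hM : ‖w‖ ≤ M) : IsSkewFamily (interaction w) M :=
  ⟨continuous_interaction w, fun t => (norm_interaction_le w t).trans hM,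
    fun t f => re_inner_interaction hw t f⟩

/-- A uniformly bounded sequence of operators that tends to zero strongly is uniformly small on
compact sets. -/
theorem eventually_forall_norm_le_of_isCompact {E F : Type*} [NormedAddCommGroup E]
    [NormedSpace ℂ E] [NormedAddCommGroup F] [NormedSpace ℂ F] {T : ℕ → E →L[ℂ] F} {C : ℝ≥0}
    (hC : ∀ m, ‖T m‖ ≤ C) (hT : ∀ x, Tendsto (fun m => T m x) atTop (𝓝 0)) {K : Set E}
    (hK : IsCompact K) {δ : ℝ} (hδ : 0 < δ) : ∀ᶠ m in atTop, ∀ x ∈ K, ‖T m x‖ ≤ δ := by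
  refine hK.induction_on (p := fun K => ∀ᶠ m in atTop, ∀ x ∈ K, ‖T m x‖ ≤ δ) (by simp)
    (fun s t hst ht => ht.mono fun m hm x hx => hm x (hst hx)) (fun s t hs ht => ?_)
    (fun x hx => ?_)
  · filter_upwards [hs, ht] with m h1 h2 x hx
    exact hx.elim (h1 x) (h2 x)
  · refine ⟨Metric.ball x (δ / 2 / (C + 1)),
      mem_nhdsWithin_of_mem_nhds (Metric.ball_mem_nhds _ (by positivity)), ?_⟩
    have h1 := (tendsto_zero_iff_norm_tendsto_zero.1 (hT x)).eventually
      (gt_mem_nhds (half_pos hδ))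
    filter_upwards [h1] with m hm y hy
    have h2 : T m y = T m x + T m (y - x) := by rw [map_sub]; abel
    have h3 : ‖T m (y - x)‖ ≤ δ / 2 := by
      refine ((T m).le_opNorm _).trans ?_
      rw [Metric.mem_ball, dist_eq_norm] at hy
      calc ‖T m‖ * ‖y - x‖ ≤ (C + 1) * (δ / 2 / (C + 1)) := by
            gcongr
            linarith [hC m]
        _ = δ / 2 := by field_simp
    rw [h2]
    linarith [norm_add_le (T m x) (T m (y - x))]

/-- A compactly supported potential that escapes to infinity is eventually small on any given free
solution, uniformly for bounded times. -/
theorem eventually_norm_interaction_scaledPotentialB_le {n : ℕ} {W : Space n → ℝ}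
    (hW : Continuous W) (hWs : HasCompactSupport W) {ε : ℝ} (hε : 0 < ε) {c : ℕ → Space n}
    (hc : Tendsto (fun m => ‖c m‖) atTop atTop) (f : L2 n) (s t : ℝ) {δ : ℝ} (hδ : 0 < δ) :
    ∀ᶠ m in atTop, ∀ τ ∈ Set.Icc s t,
      ‖interaction (scaledPotentialB hW hWs ε (c m)) τ f‖ ≤ δ := by
  obtain ⟨C, hC⟩ := norm_scaledPotentialB_le hW hWs ε
  have hT : ∀ g : L2 n, Tendsto (fun m => mulL2 (scaledPotentialB hW hWs ε (c m)) g) atTop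
      (𝓝 0) := by
    intro g
    refine tendsto_mulL2_zero (C := C)
      (fun m x => (BoundedContinuousFunction.norm_coe_le_norm _ x).trans (hC (c m))) (fun x => ?_) g
    have h1 : Tendsto (fun m => ε⁻¹ • (x - c m)) atTop (cocompact (Space n)) := by
      rw [← Metric.cobounded_eq_cocompact, ← tendsto_norm_atTop_iff_cobounded]
      have h2 : Tendsto (fun m => ε⁻¹ * (‖c m‖ - ‖x‖)) atTop atTop :=
        (tendsto_atTop_add_const_right _ (-‖x‖) hc).const_mul_atTop (inv_pos.2 hε)
      refine tendsto_atTop_mono (fun m => ?_) h2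
      rw [norm_smul, Real.norm_of_nonneg (inv_pos.2 hε).le, norm_sub_rev]
      exact mul_le_mul_of_nonneg_left (norm_sub_norm_le _ _) (inv_pos.2 hε).le
    have h3 := hasCompactSupport_iff_eventuallyEq.1 hWs
    rw [coclosedCompact_eq_cocompact] at h3
    refine tendsto_const_nhds.congr' ?_
    filter_upwards [h1.eventually h3] with m hm
    change 0 = ((ε⁻¹ ^ 2 * W (ε⁻¹ • (x - c m)) : ℝ) : ℂ)
    rw [hm]
    simp
  have hK : IsCompact ((fun τ => free τ f) '' Set.Icc s t) :=
    isCompact_Icc.image (continuous_free f)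
  filter_upwards [eventually_forall_norm_le_of_isCompact
    (fun m => (norm_mulL2_le _).trans (hC (c m))) hT hK hδ] with m hm τ hτ
  rw [norm_interaction_apply]
  exact hm _ ⟨τ, hτ, rfl⟩

theorem exists_rescale_schwartz {n : ℕ} {ε : ℝ} (hε : 0 < ε) (c : Space n) (u : 𝓢(Space n, ℂ)) :
    ∃ g : 𝓢(Space n, ℂ), ∀ x, g x = rescale ε c u x := by
  have h1 : Function.HasTemperateGrowth fun x : Space n => ε⁻¹ • (x - c) :=
    (ε⁻¹ • ContinuousLinearMap.id ℝ (Space n)).hasTemperateGrowth.comp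
      (f := fun x => x - c) (by fun_prop)
  have h2 : AntilipschitzWith ε.toNNReal fun x : Space n => ε⁻¹ • (x - c) := by
    refine AntilipschitzWith.of_le_mul_dist fun x y => ?_
    rw [dist_smul₀, dist_sub_right, Real.coe_toNNReal ε hε.le, norm_inv, Real.norm_of_nonneg hε.le,
      mul_inv_cancel_left₀ hε.ne']
  exact ⟨SchwartzMap.compCLMOfAntilipschitz ℂ h1 h2 u, fun x => rfl⟩

theorem rescale_boundState {n : ℕ} {W : Space n → ℝ} (hW : Continuous W)
    (hWs : HasCompactSupport W) {u : 𝓢(Space n, ℂ)}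
    (hu : ∀ x, -(Δ (u : Space n → ℂ)) x + (W x : ℂ) * u x + u x = 0) {ε : ℝ} {c : Space n}
    {g : 𝓢(Space n, ℂ)} (hg : ∀ x, g x = rescale ε c u x) (x : Space n) :
    -(Δ (g : Space n → ℂ)) x + scaledPotentialB hW hWs ε c x * g x + (ε⁻¹ ^ 2 : ℝ) * g x = 0 := by
  have h1 : (g : Space n → ℂ) = fun x => u (ε⁻¹ • (x - c)) := funext hg
  rw [h1, laplacian_comp_affine (u.smooth 2)]
  change -(ε⁻¹ ^ 2 • _) + ((ε⁻¹ ^ 2 * W (ε⁻¹ • (x - c)) : ℝ) : ℂ) * _ + _ = 0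
  rw [Complex.real_smul]
  push_cast
  linear_combination ((ε : ℂ)⁻¹ ^ 2) * hu (ε⁻¹ • (x - c))

theorem eLpNorm_rescale {n : ℕ} {F : Type*} [NormedAddCommGroup F] {ε : ℝ} (hε : 0 < ε)
    (c : Space n) (f : Space n → F) (q : ℝ≥0∞) :
    eLpNorm (rescale ε c f) q volume
      = ENNReal.ofReal ε ^ (n * (1 / q).toReal) * eLpNorm f q volume := by
  let e : Space n ≃ₜ Space n :=
    (Homeomorph.subRight c).trans (Homeomorph.smulOfNeZero ε⁻¹ (inv_ne_zero hε.ne'))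
  have h1 : Measure.map e volume = ENNReal.ofReal ε ^ n • (volume : Measure (Space n)) := by
    have h2 : (e : Space n → Space n) = (fun x => ε⁻¹ • x) ∘ fun x => x - c := rfl
    rw [h2, ← Measure.map_map (by fun_prop) (by fun_prop), map_sub_right_eq_self,
      Measure.map_addHaar_smul _ (inv_ne_zero hε.ne'), ← ENNReal.ofReal_pow hε.le]
    congr 2
    rw [finrank_euclideanSpace_fin, inv_pow, inv_inv, abs_of_pos (by positivity)]
  have h3 : eLpNorm (rescale ε c f) q volume = eLpNorm f q (Measure.map e volume) :=
    (e.measurableEmbedding.eLpNorm_map_measure (g := f)).symm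
  have h4 : ENNReal.ofReal ε ^ n ≠ 0 := pow_ne_zero _ (by simpa using hε)
  rw [h3, h1, eLpNorm_smul_measure_of_ne_zero h4, smul_eq_mul, ENNReal.rpow_mul,
    ENNReal.rpow_natCast]

theorem norm_exp_neg_I_mul (r : ℝ) : ‖Complex.exp (-(Complex.I * r))‖ = 1 := by
  rw [← mul_neg, ← Complex.ofReal_neg, Complex.norm_exp_I_mul_ofReal]

theorem free_boundStateWave {n : ℕ} (lam : ℝ) (f : L2 n) (τ : ℝ) :
    free τ (boundStateWave lam f τ) = Complex.exp (-(Complex.I * (lam * τ : ℝ))) • f := by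
  rw [boundStateWave, map_smul, free_free_neg]

theorem norm_boundStateWave {n : ℕ} (lam : ℝ) (f : L2 n) (τ : ℝ) :
    ‖boundStateWave lam f τ‖ = ‖f‖ := by
  rw [boundStateWave, norm_smul, (free (-τ)).norm_map, norm_exp_neg_I_mul, one_mul]

theorem eLpNorm_smul_of_norm_eq_one {n : ℕ} {c : ℂ} (hc : ‖c‖ = 1) (f : L2 n) (q : ℝ≥0∞) :
    eLpNorm (c • f : L2 n) q volume = eLpNorm f q volume := by
  rw [eLpNorm_congr_ae (Lp.coeFn_smul c f), eLpNorm_const_smul, ← ofReal_norm, hc,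
    ENNReal.ofReal_one, one_mul]

theorem exists_scaled_boundState {n : ℕ} {W : Space n → ℝ} (hW : Continuous W)
    (hWs : HasCompactSupport W) {u₀ : 𝓢(Space n, ℂ)}
    (hu₀ : ∀ x, -(Δ (u₀ : Space n → ℂ)) x + (W x : ℂ) * u₀ x + u₀ x = 0)
    {ε : ℝ} (hε : 0 < ε) (c : Space n) :
    ∃ f : L2 n, (∀ q, eLpNorm f q volume = eLpNorm (rescale ε c u₀) q volume) ∧
      ∀ τ, HasDerivAt (boundStateWave (ε⁻¹ ^ 2) f)
        (interaction (scaledPotentialB hW hWs ε c) τ (boundStateWave (ε⁻¹ ^ 2) f τ)) τ := by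
  obtain ⟨g, hg⟩ := exists_rescale_schwartz hε c u₀
  have hpde := rescale_boundState hW hWs hu₀ hg
  have hlam : 0 < ε⁻¹ ^ 2 := by positivity
  obtain ⟨f, hf⟩ : ∃ f : L2 n, f = g.toLp 2 volume := ⟨_, rfl⟩
  refine ⟨f, fun q => ?_, fun τ => ?_⟩
  · rw [hf, eLpNorm_congr_ae (g.coeFn_toLp 2 volume)]
    exact congrArg (fun f => eLpNorm f q volume) (funext hg)
  · rw [hf]
    exact hasDerivAt_boundStateWave hlam hpde τ

/-- For each sequence of scales `ε k` and durations there are rescaled copies of the potential `W`,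
switched on one after the other, and global solutions that are standing waves on one of the time
intervals. -/
theorem exists_isSolution_standingWave {n : ℕ} (hn : 0 < n) {W : Space n → ℝ} (hW : Continuous W)
    (hWs : HasCompactSupport W) {u₀ : 𝓢(Space n, ℂ)}
    (hu₀ : ∀ x, -(Δ (u₀ : Space n → ℂ)) x + (W x : ℂ) * u₀ x + u₀ x = 0)
    {ε : ℕ → ℝ} (hε : ∀ k, 0 < ε k) {t : ℕ → ℝ} (ht0 : t 0 = 0) (ht : Monotone t) :
    ∃ (c : ℕ → Space n) (u : ℕ → ℝ → L2 n), ∀ k,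
      IsSolution (Set.Ici 0) (piecewiseIco t fun j _ => scaledPotential W (ε j) (c j)) (u k) ∧
      (∀ q, ∀ τ ∈ Set.Ico (t k) (t (k + 1)),
        eLpNorm (u k τ) q volume = eLpNorm (rescale (ε k) (c k) u₀) q volume) ∧
      ‖u k 0‖ₑ = eLpNorm (rescale (ε k) (c k) u₀) 2 volume := by
  let z : ℕ → Space n := fun m => EuclideanSpace.single ⟨0, hn⟩ (m : ℝ)
  have hz : Tendsto (fun m => ‖z m‖) atTop atTop := by
    simpa [z] using tendsto_natCast_atTop_atTop (R := ℝ)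
  clear_value z
  choose M hM using fun j => norm_scaledPotentialB_le hW hWs (ε j)
  choose f hf hfd using fun j m => exists_scaled_boundState hW hWs hu₀ (hε j) (z m)
  obtain ⟨m, a, G, h⟩ := exists_concatenation ht0 ht
    (B := fun j m => interaction (scaledPotentialB hW hWs (ε j) (z m))) (M := M)
    (fun j m => isSkewFamily_interaction (fun x => Complex.ofReal_im _) (hM j (z m)))
    (fun j f δ hδ => eventually_norm_interaction_scaledPotentialB_le hW hWs (hε j) hz f _ _ hδ)
    (φ := fun j m => boundStateWave ((ε j)⁻¹ ^ 2) (f j m)) hfd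
  refine ⟨fun k => z (m k), fun k τ => free τ (a k τ), fun k => ?_⟩
  obtain ⟨h1, h2, h3, h4, h5, h6, h7⟩ := h k
  refine ⟨isSolution_of_interaction h1 (fun _ => h2.intervalIntegrable) h3
    (Eventually.of_forall fun τ => ?_), fun q τ hτ => ?_, ?_⟩
  · by_cases hτ : ∃ j, τ ∈ Set.Ico (t j) (t (j + 1))
    · obtain ⟨j, hj⟩ := hτ
      rw [h4 j τ hj, interaction_apply, map_smul, free_free_neg, smul_smul,
        show -Complex.I * Complex.I = 1 by simp, one_smul, piecewiseIco_of_mem ht _ hj]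
      exact coeFn_mulL2 _ _
    · push Not at hτ
      rw [h5 τ hτ, piecewiseIco_of_notMem _ hτ, map_zero, smul_zero]
      filter_upwards [Lp.coeFn_zero ℂ 2 (volume : Measure (Space n))] with x hx
      rw [hx]
      simp
  · beta_reduce
    rw [h6 τ (Set.Ico_subset_Icc_self hτ), free_boundStateWave,
      eLpNorm_smul_of_norm_eq_one (norm_exp_neg_I_mul _), hf]
  · beta_reduce
    rw [← hf, ← Lp.enorm_def, ← ofReal_norm, ← ofReal_norm, (free 0).norm_map, h7,
      norm_boundStateWave]

theorem measurable_uncurry_piecewiseIco {n : ℕ} {t : ℕ → ℝ} (ht : Monotone t)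
    {F : ℕ → Space n → ℝ} (hF : ∀ j, Measurable (F j)) :
    Measurable (Function.uncurry (piecewiseIco t fun j _ => F j)) := by
  let A : Option ℕ → Set ℝ := fun o =>
    o.elim (⋃ j, Set.Ico (t j) (t (j + 1)))ᶜ fun j => Set.Ico (t j) (t (j + 1))
  let g : Option ℕ → ℝ × Space n → ℝ := fun o => o.elim 0 fun j x => F j x.2
  have hAg : ∀ o, Set.EqOn (Function.uncurry (piecewiseIco t fun j _ => F j)) (g o)
      (Prod.fst ⁻¹' A o) := by
    rintro (_ | j) ⟨τ, x⟩ hτ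
    · have : ∀ j, τ ∉ Set.Ico (t j) (t (j + 1)) := fun j hj => hτ (Set.mem_iUnion.2 ⟨j, hj⟩)
      simp [Function.uncurry, piecewiseIco_of_notMem _ this, g]
    · have hτ' : τ ∈ Set.Ico (t j) (t (j + 1)) := hτ
      simp [Function.uncurry, piecewiseIco_of_mem ht _ hτ', g]
  obtain ⟨f, hf, hfg⟩ := exists_measurable_piecewise (fun o => Prod.fst ⁻¹' A o)
    (fun o => measurable_fst (by
      cases o with
      | none => exact (MeasurableSet.iUnion fun j => measurableSet_Ico).compl
      | some j => exact measurableSet_Ico)) g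
    (fun o => by
      cases o with
      | none => exact (measurable_const : Measurable fun _ : ℝ × Space n => (0 : ℝ))
      | some j => exact (hF j).comp measurable_snd)
    (fun i j _ x hx => by rw [← hAg i hx.1, ← hAg j hx.2])
  convert! hf using 1
  ext ⟨τ, x⟩
  by_cases hτ : ∃ j, τ ∈ Set.Ico (t j) (t (j + 1))
  · obtain ⟨j, hj⟩ := hτ
    rw [hAg (some j) (x := (τ, x)) hj, hfg (some j) (x := (τ, x)) hj]
  · have hτ' : (τ, x) ∈ Prod.fst ⁻¹' A none := by
      intro hh
      exact hτ (Set.mem_iUnion.1 hh)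
    rw [hAg none hτ', hfg none hτ']

theorem memMixed_piecewiseIco {n : ℕ} (I : Set ℝ) {r s : ℝ≥0∞} (hr0 : r ≠ 0) (hr : r ≠ ⊤)
    {t : ℕ → ℝ} (ht : Monotone t) {F : ℕ → Space n → ℝ} (hF : ∀ j, Measurable (F j))
    (hsum : ∑' j, ENNReal.ofReal (t (j + 1) - t j) * eLpNorm (F j) s volume ^ r.toReal ≠ ⊤) :
    MemMixed I r s (piecewiseIco t fun j _ => F j) := by
  have hρ : 0 < r.toReal := ENNReal.toReal_pos hr0 hr
  refine ⟨(measurable_uncurry_piecewiseIco ht hF).aestronglyMeasurable, ?_⟩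
  rw [mixedNorm, eLpNorm_lt_top_iff_lintegral_rpow_enorm_lt_top hr0 hr]
  refine lt_of_le_of_lt ?_ hsum.lt_top
  calc ∫⁻ τ in I, ‖eLpNorm (piecewiseIco t (fun j _ => F j) τ) s volume‖ₑ ^ r.toReal
      ≤ ∫⁻ τ, ‖eLpNorm (piecewiseIco t (fun j _ => F j) τ) s volume‖ₑ ^ r.toReal :=
        setLIntegral_le_lintegral _ _
    _ ≤ ∫⁻ τ, ∑' j, (Set.Ico (t j) (t (j + 1))).indicator
          (fun _ => eLpNorm (F j) s volume ^ r.toReal) τ := by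
        refine lintegral_mono fun τ => ?_
        rw [enorm_eq_self]
        by_cases hτ : ∃ j, τ ∈ Set.Ico (t j) (t (j + 1))
        · obtain ⟨j, hj⟩ := hτ
          rw [piecewiseIco_of_mem ht _ hj]
          refine le_trans (le_of_eq ?_) (ENNReal.le_tsum j)
          rw [Set.indicator_of_mem hj]
        · push Not at hτ
          rw [piecewiseIco_of_notMem _ hτ, eLpNorm_zero, ENNReal.zero_rpow_of_pos hρ]
          exact zero_le
    _ = ∑' j, ENNReal.ofReal (t (j + 1) - t j) * eLpNorm (F j) s volume ^ r.toReal := by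
        rw [lintegral_tsum fun j => (measurable_const.indicator measurableSet_Ico).aemeasurable]
        refine tsum_congr fun j => ?_
        rw [lintegral_indicator measurableSet_Ico, setLIntegral_const, Real.volume_Ico, mul_comm]

theorem eLpNorm_scaledPotential {n : ℕ} (W : Space n → ℝ) {ε : ℝ} (hε : 0 < ε) (c : Space n)
    (s : ℝ≥0∞) : eLpNorm (scaledPotential W ε c) s volume
      = ENNReal.ofReal (ε ^ (n * (1 / s).toReal - 2)) * eLpNorm W s volume := by
  have h1 : scaledPotential W ε c = (ε⁻¹ ^ 2) • rescale ε c W := rfl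
  rw [h1, eLpNorm_const_smul, eLpNorm_rescale hε, ← mul_assoc,
    Real.enorm_of_nonneg (by positivity), ENNReal.ofReal_rpow_of_pos hε,
    ← ENNReal.ofReal_mul (by positivity)]
  congr 2
  rw [Real.rpow_sub hε, Real.rpow_two]
  field_simp

theorem memMixed_scaledPotential {n : ℕ} (I : Set ℝ) {r s : ℝ≥0∞} (hr0 : r ≠ 0) (hr : r ≠ ⊤)
    {W : Space n → ℝ} (hW : Continuous W) (hWs : eLpNorm W s volume ≠ ⊤) {t N ε : ℕ → ℝ}
    (ht : Monotone t) (hN : ∀ j, 0 ≤ N j) (hε : ∀ j, 0 < ε j)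
    (htN : ∀ j, t (j + 1) - t j = N j * ε j ^ 2) (c : ℕ → Space n)
    (h : ∀ j, N j * ε j ^ (2 + r.toReal * (n * (1 / s).toReal - 2)) ≤ (1 / 2) ^ j) :
    MemMixed I r s (piecewiseIco t fun j _ => scaledPotential W (ε j) (c j)) := by
  have hm : ∀ j, Measurable (scaledPotential W (ε j) (c j)) := fun j =>
    Continuous.measurable (by unfold scaledPotential rescale; fun_prop)
  refine memMixed_piecewiseIco I hr0 hr ht hm (ne_top_of_le_ne_top (b := ∑' j : ℕ,
    ENNReal.ofReal ((1 / 2) ^ j) * eLpNorm W s volume ^ r.toReal) ?_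
    (ENNReal.tsum_le_tsum fun j => ?_))
  · rw [ENNReal.tsum_mul_right]
    refine ENNReal.mul_ne_top ?_ (ENNReal.rpow_ne_top_of_nonneg ENNReal.toReal_nonneg hWs)
    rw [← ENNReal.ofReal_tsum_of_nonneg (fun j => by positivity) summable_geometric_two]
    exact ENNReal.ofReal_ne_top
  · rw [eLpNorm_scaledPotential W (hε j), htN, ENNReal.mul_rpow_of_nonneg _ _
      ENNReal.toReal_nonneg, ← mul_assoc, ENNReal.ofReal_rpow_of_nonneg
      (Real.rpow_nonneg (hε j).le _) ENNReal.toReal_nonneg, ← ENNReal.ofReal_mul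
      (mul_nonneg (hN j) (sq_nonneg _))]
    gcongr
    refine le_trans (le_of_eq ?_) (h j)
    rw [← Real.rpow_mul (hε j).le, Real.rpow_add (hε j), Real.rpow_two,
      mul_comm (_ - _ : ℝ) r.toReal]
    ring

theorem le_strichartzNorm {n : ℕ} {I : Set ℝ} {p q D : ℝ≥0∞} (hp0 : p ≠ 0) (hp : p ≠ ⊤)
    {u : ℝ → L2 n} {s t : ℝ} (hI : Set.Ico s t ⊆ I)
    (h : ∀ τ ∈ Set.Ico s t, eLpNorm (u τ) q volume = D) :
    D * ENNReal.ofReal (t - s) ^ (1 / p).toReal ≤ strichartzNorm I p q u := by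
  have h1 : eLpNorm (fun _ : ℝ => D) p (volume.restrict (Set.Ico s t))
      ≤ strichartzNorm I p q u := by
    rw [strichartzNorm, mixedNorm]
    refine le_trans (le_of_eq ?_) (eLpNorm_mono_measure _ (Measure.restrict_mono hI le_rfl))
    refine eLpNorm_congr_ae ?_
    filter_upwards [ae_restrict_mem measurableSet_Ico] with τ hτ using (h τ hτ).symm
  rw [eLpNorm_const' _ hp0 hp] at h1
  simpa using h1

theorem Admissible.exponents {n : ℕ} (hn : 0 < n) {p q : ℝ≥0∞} (h : Admissible n p q)
    (hpq : (p, q) ≠ (⊤, 2)) :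
    p ≠ 0 ∧ p ≠ ⊤ ∧ 2 * (1 / p).toReal + n * (1 / q).toReal = n / 2 := by
  obtain ⟨h1, h2, h3, -⟩ := h
  have hp0 : p ≠ 0 := (two_pos.trans_le h2).ne'
  have hq0 : q ≠ 0 := (two_pos.trans_le h3).ne'
  have h4 : (1 / p).toReal + n / 2 * (1 / q).toReal = n / 4 := by
    have h5 := congrArg ENNReal.toReal h1
    rw [ENNReal.toReal_add (by simpa using hp0) (ENNReal.div_ne_top (by simp) (by simp [hq0]))]
      at h5
    simp only [ENNReal.toReal_div, ENNReal.toReal_mul, ENNReal.toReal_natCast,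
      ENNReal.toReal_ofNat] at h5
    rw [← h5]
    simp only [ENNReal.toReal_div, ENNReal.toReal_one]
    ring
  refine ⟨hp0, fun hp => hpq ?_, by linarith⟩
  rw [hp] at h4
  have hn' : (0 : ℝ) < n := by exact_mod_cast hn
  simp only [one_div, ENNReal.inv_top, ENNReal.toReal_zero, zero_add, ENNReal.toReal_inv] at h4
  have h6 : q.toReal⁻¹ = 2⁻¹ := by
    have : (n : ℝ) * (2 * q.toReal⁻¹ - 1) = 0 := by linarith
    rcases mul_eq_zero.1 this with h | h <;> linarith
  have h7 : q.toReal = 2 := inv_injective h6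
  have h8 : q = 2 := by
    rw [← ENNReal.ofReal_toReal (a := q) (fun hq => by simp [hq] at h7), h7]
    simp
  rw [hp, h8]

theorem eLpNorm_ne_zero_of_forall_ne_zero {n : ℕ} {u : 𝓢(Space n, ℂ)} (hu : ∀ x, u x ≠ 0)
    {q : ℝ≥0∞} (hq : q ≠ 0) : eLpNorm u q volume ≠ 0 := by
  rw [Ne, eLpNorm_eq_zero_iff u.continuous.aestronglyMeasurable hq]
  intro h
  obtain ⟨x, hx⟩ := h.exists
  exact hu x hx

theorem strichartz_ratio_le {n : ℕ} {u₀ : 𝓢(Space n, ℂ)} (hu₀ : ∀ x, u₀ x ≠ 0)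
    {p q : ℝ≥0∞} (hp0 : p ≠ 0) (hp : p ≠ ⊤)
    (hpq : 2 * (1 / p).toReal + n * (1 / q).toReal = n / 2) {ε N s t : ℝ} (hε : 0 < ε) (hN : 0 ≤ N)
    (hst : t - s = N * ε ^ 2) {c : Space n} {I : Set ℝ} (hI : Set.Ico s t ⊆ I) {u : ℝ → L2 n}
    (hu : ∀ τ ∈ Set.Ico s t, eLpNorm (u τ) q volume = eLpNorm (rescale ε c u₀) q volume)
    (hu0 : ‖u 0‖ₑ = eLpNorm (rescale ε c u₀) 2 volume) :
    ENNReal.ofReal N ^ (1 / p).toReal * (eLpNorm u₀ q volume / eLpNorm u₀ 2 volume)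
      ≤ strichartzNorm I p q u / ‖u 0‖ₑ := by
  have he0 : ENNReal.ofReal ε ≠ 0 := by simpa using hε
  have he1 : ENNReal.ofReal ε ≠ ⊤ := ENNReal.ofReal_ne_top
  have hU0 := eLpNorm_ne_zero_of_forall_ne_zero hu₀ two_ne_zero
  have hU1 : eLpNorm u₀ 2 volume ≠ ⊤ := (u₀.memLp 2 volume).2.ne
  have h2 : (n : ℝ) * (1 / (2 : ℝ≥0∞)).toReal = n / 2 := by
    simp [div_eq_mul_inv]
  have hlow := le_strichartzNorm hp0 hp hI hu
  rw [eLpNorm_rescale hε, hst, ENNReal.ofReal_mul hN, ENNReal.ofReal_pow hε.le,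
    ENNReal.mul_rpow_of_nonneg _ _ ENNReal.toReal_nonneg, ← ENNReal.rpow_natCast,
    ← ENNReal.rpow_mul] at hlow
  rw [hu0, eLpNorm_rescale hε, h2]
  have hden0 : ENNReal.ofReal ε ^ ((n : ℝ) / 2) ≠ 0 := by
    rw [Ne, ENNReal.rpow_eq_zero_iff]
    simp [he0, he1]
  have hden1 : ENNReal.ofReal ε ^ ((n : ℝ) / 2) ≠ ⊤ := by
    rw [Ne, ENNReal.rpow_eq_top_iff]
    simp [he0, he1]
  rw [ENNReal.le_div_iff_mul_le (Or.inl (mul_ne_zero hden0 hU0))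
    (Or.inl (ENNReal.mul_ne_top hden1 hU1))]
  refine le_trans (le_of_eq ?_) hlow
  rw [← hpq, ENNReal.rpow_add _ _ he0 he1, ENNReal.div_eq_inv_mul (a := eLpNorm u₀ q volume)]
  push_cast
  calc _ = ((eLpNorm u₀ 2 volume)⁻¹ * eLpNorm u₀ 2 volume) *
      (ENNReal.ofReal ε ^ (n * (1 / q).toReal) * eLpNorm u₀ q volume *
      (ENNReal.ofReal N ^ (1 / p).toReal * ENNReal.ofReal ε ^ (2 * (1 / p).toReal))) := by ring
    _ = _ := by rw [ENNReal.inv_mul_cancel hU0 hU1, one_mul]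

theorem tendsto_ofReal_rpow_mul_top {x : ℝ} (hx : 0 < x) {C : ℝ≥0∞} (hC : C ≠ 0) :
    Tendsto (fun k : ℕ => ENNReal.ofReal (k + 1) ^ x * C) atTop (𝓝 ⊤) := by
  have h1 : Tendsto (fun k : ℕ => ENNReal.ofReal (k + 1)) atTop (𝓝 ⊤) :=
    ENNReal.tendsto_ofReal_atTop.comp (tendsto_atTop_add_const_right _ _
      tendsto_natCast_atTop_atTop)
  have h2 := h1.ennrpow_const x
  rw [ENNReal.top_rpow_of_pos hx] at h2
  have h3 := ENNReal.Tendsto.mul_const (b := C) h2 (Or.inl ENNReal.top_ne_zero)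
  rwa [ENNReal.top_mul hC] at h3

/-- Start of the `k`-th time interval, for the scales `ε` and durations `(j + 1) ε_j²`. -/
def startTime (ε : ℕ → ℝ) (k : ℕ) : ℝ := ∑ j ∈ Finset.range k, ((j : ℝ) + 1) * ε j ^ 2

theorem startTime_succ_sub (ε : ℕ → ℝ) (k : ℕ) :
    startTime ε (k + 1) - startTime ε k = ((k : ℝ) + 1) * ε k ^ 2 := by
  rw [startTime, Finset.sum_range_succ, startTime]
  ring

theorem monotone_startTime (ε : ℕ → ℝ) : Monotone (startTime ε) :=
  monotone_nat_of_le_succ fun k => by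
    have := startTime_succ_sub ε k
    have : 0 ≤ ((k : ℝ) + 1) * ε k ^ 2 := by positivity
    linarith

theorem startTime_nonneg (ε : ℕ → ℝ) (k : ℕ) : 0 ≤ startTime ε k :=
  Finset.sum_nonneg fun j _ => by positivity

/-- Blow-up of all Strichartz ratios for suitable sequences of scales. -/
theorem exists_blowup {n : ℕ} (hn : 0 < n) {r s : ℝ≥0∞} (hr0 : r ≠ 0) (hr : r ≠ ⊤)
    {ε : ℕ → ℝ} (hε : ∀ k, 0 < ε k)
    (h : ∀ j : ℕ, ((j : ℝ) + 1) * ε j ^ (2 + r.toReal * (n * (1 / s).toReal - 2)) ≤ (1 / 2) ^ j) :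
    ∃ (V : ℝ → Space n → ℝ) (u : ℕ → ℝ → L2 n), (∀ I, MemMixed I r s V) ∧
      (∀ k, IsSolution (Set.Ici 0) V (u k) ∧ u k 0 ≠ 0) ∧
      ∀ I : Set ℝ, (∀ k, Set.Ico (startTime ε k) (startTime ε (k + 1)) ⊆ I) →
        ∀ p q : ℝ≥0∞, Admissible n p q → (p, q) ≠ (⊤, 2) →
          Tendsto (fun k => strichartzNorm I p q (u k) / ‖u k 0‖ₑ) atTop (𝓝 ⊤) := by
  obtain ⟨W, u₀, hW, hWs, hu0, hu⟩ := exists_boundState n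
  obtain ⟨c, u, hcu⟩ := exists_isSolution_standingWave hn hW.continuous hWs hu hε
    (t := startTime ε) (by simp [startTime]) (monotone_startTime ε)
  refine ⟨_, u, fun I => memMixed_scaledPotential I hr0 hr hW.continuous
    (hW.continuous.memLp_of_hasCompactSupport hWs).2.ne (N := fun j => (j : ℝ) + 1)
    (monotone_startTime ε) (fun j => by positivity) hε (startTime_succ_sub ε) c h,
    fun k => ⟨(hcu k).1, fun h0 => ?_⟩, fun I hI p q hpq hne => ?_⟩
  · have h1 := (hcu k).2.2
    rw [h0, enorm_zero, eLpNorm_rescale (hε k)] at h1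
    rcases mul_eq_zero.1 h1.symm with h2 | h2
    · rw [ENNReal.rpow_eq_zero_iff] at h2
      simp [(hε k).not_ge] at h2
    · exact eLpNorm_ne_zero_of_forall_ne_zero hu0 two_ne_zero h2
  · obtain ⟨hp0, hp, hexp⟩ := hpq.exponents hn hne
    have hq0 : q ≠ 0 := (two_pos.trans_le hpq.2.2.1).ne'
    have hpos : 0 < (1 / p).toReal :=
      ENNReal.toReal_pos (by simpa using hp) (by simpa using hp0)
    refine tendsto_nhds_top_mono (tendsto_ofReal_rpow_mul_top hpos (ENNReal.div_ne_zero.2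
      ⟨eLpNorm_ne_zero_of_forall_ne_zero hu0 hq0, (u₀.memLp 2 volume).2.ne⟩))
      (Eventually.of_forall fun k => ?_)
    exact strichartz_ratio_le hu0 hp0 hp hexp (hε k) (by positivity) (startTime_succ_sub ε k)
      (hI k) ((hcu k).2.1 q) (hcu k).2.2

theorem exponent_eq {n : ℕ} {r s : ℝ≥0∞} (hr0 : r ≠ 0) (hr : r ≠ ⊤) (hs : s ≠ 0) :
    2 + r.toReal * (n * (1 / s).toReal - 2)
      = 2 * r.toReal * ((1 / r + (n : ℝ≥0∞) / (2 * s)).toReal - 1) := by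
  have hρ : 0 < r.toReal := ENNReal.toReal_pos hr0 hr
  rw [ENNReal.toReal_add (by simpa using hr0) (ENNReal.div_ne_top (by simp) (by simp [hs]))]
  simp only [ENNReal.toReal_div, ENNReal.toReal_mul, ENNReal.toReal_natCast,
    ENNReal.toReal_ofNat, ENNReal.toReal_one]
  rw [show (n : ℝ) / (2 * s.toReal) = n * (1 / s.toReal) / 2 by rw [← div_div]; ring]
  field_simp
  ring

theorem eventually_mul_rpow_le {e : ℝ} (he : 0 < e) (N : ℝ) {δ : ℝ} (hδ : 0 < δ) :
    ∀ᶠ x : ℝ in 𝓝[>] 0, N * x ^ e ≤ δ := by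
  have h1 : Tendsto (fun x : ℝ => N * x ^ e) (𝓝[>] 0) (𝓝 0) := by
    have h2 : Tendsto (fun x : ℝ => N * x ^ e) (𝓝 0) (𝓝 (N * 0 ^ e)) :=
      (Real.continuousAt_rpow_const 0 e (Or.inr he.le)).tendsto.const_mul N
    rw [Real.zero_rpow he.ne', mul_zero] at h2
    exact h2.mono_left nhdsWithin_le_nhds
  exact (h1.eventually (gt_mem_nhds hδ)).mono fun _ h => h.le

theorem exists_scale {e : ℝ} (he : e ≠ 0) (N : ℝ) {δ : ℝ} (hδ : 0 < δ) :
    ∃ x : ℝ, 0 < x ∧ N * x ^ e ≤ δ := by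
  rcases he.lt_or_gt with he | he
  · obtain ⟨x, h1, h2⟩ := ((eventually_mul_rpow_le (neg_pos.2 he) N hδ).and
      self_mem_nhdsWithin).exists
    have hx : 0 < x := h2
    refine ⟨x⁻¹, inv_pos.2 hx, ?_⟩
    rwa [Real.inv_rpow hx.le, ← Real.rpow_neg hx.le]
  · obtain ⟨x, h1, h2⟩ := ((eventually_mul_rpow_le he N hδ).and self_mem_nhdsWithin).exists
    exact ⟨x, h2, h1⟩

theorem standingWave_eq_free {n : ℕ} (f : L2 n) :
    standingWave f = fun t => free t (boundStateWave 1 f t) := by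
  ext1 t
  rw [free_boundStateWave, standingWave, one_mul]

theorem isSolution_standingWave {n : ℕ} {W : Space n → ℝ} (hW : Continuous W)
    (hWs : HasCompactSupport W) {u : 𝓢(Space n, ℂ)}
    (hu : ∀ x, -(Δ (u : Space n → ℂ)) x + (W x : ℂ) * u x + u x = 0) {f : L2 n}
    (hf : f = u.toLp 2 volume) : IsSolution (Set.Ici 0) (fun _ => W) (standingWave f) := by
  set w := scaledPotentialB hW hWs 1 0
  have hw : ∀ x, w x = W x := fun x => by
    change ((scaledPotential W 1 0 x : ℝ) : ℂ) = W x
    simp [scaledPotential, rescale]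
  have hd : ∀ t, HasDerivAt (boundStateWave 1 f) (interaction w t (boundStateWave 1 f t)) t := by
    intro t
    rw [hf]
    refine hasDerivAt_boundStateWave one_pos (fun x => ?_) t
    rw [hw]
    simpa using hu x
  have hc : Continuous (boundStateWave 1 f) :=
    continuous_iff_continuousAt.2 fun t => (hd t).continuousAt
  have hG : Continuous fun t => interaction w t (boundStateWave 1 f t) :=
    (isSkewFamily_interaction (M := ‖w‖₊) (fun x => by rw [hw]; exact Complex.ofReal_im _)
      le_rfl).continuous_comp hc
  rw [standingWave_eq_free]
  refine isSolution_of_interaction hc (fun t => hG.intervalIntegrable _ _) (fun t => ?_)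
    (Eventually.of_forall fun τ => ?_)
  · rw [intervalIntegral.integral_eq_sub_of_hasDerivAt (fun τ _ => hd τ)
      (hG.intervalIntegrable _ _)]
    abel
  · rw [interaction_apply, map_smul, free_free_neg, smul_smul,
      show -Complex.I * Complex.I = 1 by simp, one_smul]
    filter_upwards [coeFn_mulL2 w (free τ (boundStateWave 1 f τ))] with x hx
    rw [hx, hw]

theorem strichartzNorm_standingWave {n : ℕ} {f : L2 n} {p q : ℝ≥0∞} (hp0 : p ≠ 0) (hp : p ≠ ⊤)
    (hf : eLpNorm f q volume ≠ 0) :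
    strichartzNorm (Set.Ici 0) p q (standingWave f) = ⊤ := by
  have h1 : ∀ t, eLpNorm (standingWave f t) q volume = eLpNorm f q volume := fun t =>
    eLpNorm_smul_of_norm_eq_one (norm_exp_neg_I_mul t) f q
  have hpos : 0 < 1 / p.toReal := one_div_pos.2 (ENNReal.toReal_pos hp0 hp)
  rw [strichartzNorm, mixedNorm]
  simp_rw [h1]
  rw [eLpNorm_const' _ hp0 hp, Measure.restrict_apply_univ, Real.volume_Ici,
    ENNReal.top_rpow_of_pos hpos, enorm_eq_self, ENNReal.mul_top hf]

end Schrodinger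

end

theorem theorem1p3 (n : ℕ) (hn : 2 ≤ n) :
    -- (i) a standing wave
    (∃ (W : Schrodinger.Space n → ℝ) (u₀ : Schrodinger.Space n → ℂ) (h₂ : MemLp u₀ 2 volume),
      ContDiff ℝ ∞ W ∧ HasCompactSupport W ∧
      ContDiff ℝ ∞ u₀ ∧
      (∀ σ : ℝ, 0 < σ → TemperedDistribution.MemSobolev σ 2
        ((h₂.toLp u₀ : Schrodinger.L2 n) : 𝓢'(Schrodinger.Space n, ℂ))) ∧
      (∀ x, -(Δ u₀) x + (W x : ℂ) * u₀ x + u₀ x = 0) ∧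
      (∀ s : ℝ≥0∞, 1 ≤ s → Schrodinger.MemMixed (Set.Ici 0) ⊤ s (fun _ => W)) ∧
      Schrodinger.IsSolution (Set.Ici 0) (fun _ => W)
        (Schrodinger.standingWave (h₂.toLp u₀)) ∧
      ∀ p q : ℝ≥0∞, Schrodinger.Admissible n p q → (p, q) ≠ (⊤, 2) →
        Schrodinger.strichartzNorm (Set.Ici 0) p q
          (Schrodinger.standingWave (h₂.toLp u₀)) = ⊤ ∧
        ¬ ∃ C : ℝ≥0, ∀ v : ℝ → Schrodinger.L2 n,
          Schrodinger.IsSolution (Set.Ici 0) (fun _ => W) v →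
          Schrodinger.strichartzNorm (Set.Ici 0) p q v ≤ C * ‖v 0‖ₑ) ∧
    -- (ii) failure of the global estimates
    (∀ r s : ℝ≥0∞, 1 ≤ r → r < ⊤ → (n : ℝ≥0∞) / 2 < s →
      1 / r + (n : ℝ≥0∞) / (2 * s) ≠ 1 →
      ∃ (V : ℝ → Schrodinger.Space n → ℝ) (u : ℕ → ℝ → Schrodinger.L2 n),
        Schrodinger.MemMixed (Set.Ici 0) r s V ∧
        (∀ k, Schrodinger.IsSolution (Set.Ici 0) V (u k) ∧ u k 0 ≠ 0) ∧
        ∀ p q : ℝ≥0∞, Schrodinger.Admissible n p q → (p, q) ≠ (⊤, 2) →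
          Tendsto (fun k => Schrodinger.strichartzNorm (Set.Ici 0) p q (u k) / ‖u k 0‖ₑ)
            atTop (𝓝 ⊤)) ∧
    -- (iii) failure of the local estimates
    (∀ r s : ℝ≥0∞, 1 ≤ r → r < ⊤ → (n : ℝ≥0∞) / 2 < s →
      1 < 1 / r + (n : ℝ≥0∞) / (2 * s) →
      ∀ T : ℝ, 0 < T →
      ∃ (V : ℝ → Schrodinger.Space n → ℝ) (u : ℕ → ℝ → Schrodinger.L2 n),
        Schrodinger.MemMixed (Set.Icc 0 T) r s V ∧
        (∀ k, Schrodinger.IsSolution (Set.Icc 0 T) V (u k) ∧ u k 0 ≠ 0) ∧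
        ∀ p q : ℝ≥0∞, Schrodinger.Admissible n p q → (p, q) ≠ (⊤, 2) →
          Tendsto (fun k => Schrodinger.strichartzNorm (Set.Icc 0 T) p q (u k) / ‖u k 0‖ₑ)
            atTop (𝓝 ⊤)) := by
  refine ⟨?_, ?_, ?_⟩
  · obtain ⟨W, u, hW, hWs, hu0, hu⟩ := Schrodinger.exists_boundState n
    have hsol := Schrodinger.isSolution_standingWave hW.continuous hWs hu rfl
    refine ⟨W, u, u.memLp 2 volume, hW, hWs, u.smooth ⊤, fun σ _ => ?_, hu, fun s _ => ⟨?_, ?_⟩,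
      hsol, fun p q hpq hne => ?_⟩
    · have h1 := u.memSobolev (s := σ) (p := 2)
      rwa [← Lp.toTemperedDistribution_toLp_eq (μ := volume) (p := 2) u] at h1
    · exact (hW.continuous.comp continuous_snd).aestronglyMeasurable
    · exact (memLp_top_const_enorm
        (c := eLpNorm W s volume) (hW.continuous.memLp_of_hasCompactSupport hWs).2.ne).2
    · obtain ⟨hp0, hp, -⟩ := hpq.exponents (two_pos.trans_le hn) hne
      have hq0 : q ≠ 0 := (two_pos.trans_le hpq.2.2.1).ne'
      have hD : eLpNorm ((u.memLp 2 volume).toLp u : Schrodinger.L2 n) q volume ≠ 0 := by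
        rw [eLpNorm_congr_ae (u.memLp 2 volume).coeFn_toLp]
        exact Schrodinger.eLpNorm_ne_zero_of_forall_ne_zero hu0 hq0
      have htop := Schrodinger.strichartzNorm_standingWave hp0 hp hD
      refine ⟨htop, fun ⟨C, hC⟩ => ?_⟩
      have h1 := hC _ hsol
      erw [htop] at h1
      exact absurd (top_le_iff.1 h1) (ENNReal.mul_ne_top ENNReal.coe_ne_top enorm_ne_top)
  · intro r s hr1 hr hs hrs
    have hr0 : r ≠ 0 := (one_pos.trans_le hr1).ne'
    have hs0 : s ≠ 0 := (bot_le.trans_lt hs).ne'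
    have he : 2 + r.toReal * (n * (1 / s).toReal - 2) ≠ 0 := by
      rw [Schrodinger.exponent_eq hr0 hr.ne hs0]
      refine mul_ne_zero (mul_ne_zero two_ne_zero (ENNReal.toReal_pos hr0 hr.ne).ne')
        (sub_ne_zero.2 fun h => hrs ?_)
      rwa [ENNReal.toReal_eq_one_iff] at h
    choose ε hε h using fun j : ℕ =>
      Schrodinger.exists_scale he ((j : ℝ) + 1) (δ := (1 / 2) ^ j) (by positivity)
    obtain ⟨V, u, hV, hu, hlim⟩ := Schrodinger.exists_blowup (two_pos.trans_le hn) hr0 hr.ne hε h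
    exact ⟨V, u, hV _, hu, hlim _ fun k τ hτ =>
      (Schrodinger.startTime_nonneg ε k).trans hτ.1⟩
  · intro r s hr1 hr hs hrs T hT
    have hr0 : r ≠ 0 := (one_pos.trans_le hr1).ne'
    have hs0 : s ≠ 0 := (bot_le.trans_lt hs).ne'
    have hfin : 1 / r + (n : ℝ≥0∞) / (2 * s) ≠ ⊤ :=
      ENNReal.add_ne_top.2 ⟨by simpa using hr0, ENNReal.div_ne_top (by simp) (by simp [hs0])⟩
    have he : 0 < 2 + r.toReal * (n * (1 / s).toReal - 2) := by
      rw [Schrodinger.exponent_eq hr0 hr.ne hs0]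
      refine mul_pos (mul_pos two_pos (ENNReal.toReal_pos hr0 hr.ne)) (sub_pos.2 ?_)
      simpa using (ENNReal.toReal_lt_toReal ENNReal.one_ne_top hfin).2 hrs
    have hex : ∀ j : ℕ, ∃ x : ℝ, 0 < x ∧
        ((j : ℝ) + 1) * x ^ (2 + r.toReal * (n * (1 / s).toReal - 2)) ≤ (1 / 2) ^ j ∧
        ((j : ℝ) + 1) * x ^ 2 ≤ T / 2 * (1 / 2) ^ j := by
      intro j
      obtain ⟨x, ⟨h1, h2⟩, h3⟩ := (((Schrodinger.eventually_mul_rpow_le he ((j : ℝ) + 1)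
        (δ := (1 / 2) ^ j) (by positivity)).and
        (Schrodinger.eventually_mul_rpow_le two_pos ((j : ℝ) + 1)
          (δ := T / 2 * (1 / 2) ^ j) (by positivity))).and self_mem_nhdsWithin).exists
      exact ⟨x, h3, h1, by simpa using h2⟩
    choose ε hε h hT' using hex
    obtain ⟨V, u, hV, hu, hlim⟩ := Schrodinger.exists_blowup (two_pos.trans_le hn) hr0 hr.ne hε h
    have hle : ∀ k, Schrodinger.startTime ε k ≤ T := by
      intro k
      refine (Finset.sum_le_sum fun j _ => hT' j).trans ?_
      rw [← Finset.mul_sum]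
      have := summable_geometric_two.sum_le_tsum (Finset.range k) fun j _ => by positivity
      rw [tsum_geometric_two] at this
      nlinarith
    exact ⟨V, u, hV _, fun k => ⟨(hu k).1.mono fun τ hτ => hτ.1, (hu k).2⟩,
      hlim _ fun k τ hτ => ⟨(Schrodinger.startTime_nonneg ε k).trans hτ.1,
        hτ.2.le.trans (hle _)⟩⟩
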